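/- Let $d,n\ge 1$ be integers, let $f_1,\dots,f_n:\mathbb{R}^d\to\mathbb{R}$ be convex, let $\psi:\mathbb{R}^d\to(-\infty,+\infty]$ be proper, closed and convex with domain $\operatorname{dom}\psi=\{x:\psi(x)<+\infty\}$, and suppose that each $f_i$ is $G_i$-Lipschitz on $\operatorname{dom}\psi$ for some $G_i>0$. Put $f=\frac1n\sum_{i=1}^n f_i$, $F=f+\psi$, $G_{f,1}=\frac1n\sum_{i=1}^n G_i$ and $G_{f,2}=\sqrt{\frac1n\sum_{i=1}^n G_i^2}$. For every $i$ and $x$ let $\nabla f_i(x)\in\partial f_i(x)$ be a fixed (deterministic) choice of subgradient such that for $x\in\operatorname{dom}\psi$ the linear function $u\mapsto\langle\nabla f_i(x),u\rangle$ is $G_i$-Lipschitz on $\operatorname{dom}\psi$ (for example, $\|\nabla f_i(x)\|\le G_i$). Let $T\ge n$ and $x_1\in\operatorname{dom}\psi$, let $\pi_1,\dots,\pi_{\lceil T/n\rceil}$ be mutually independent uniformly distributed random permutations of $\{1,\dots,n\}$, and, for stepsizes $\eta_t>0$ and $t=1,\dots,T$, let $$x_{t+1}=\operatorname*{arg\,min}_{x\in\mathbb{R}^d}\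 \psi(x)+\langle\nabla f_{\mathsf{i}(t)}(x_t),x\rangle+\frac{\|x-x_t\|^2}{2\eta_t},\qquad \mathsf{i}(t)=\pi_k(r)\ \text{ for } t=(k-1)n+r,\ 1\le r\le n$$ (the Random Reshuffle scheme). Let $x^{\mathrm{suffix}}_{T+1}=\frac1n\sum_{t=T-n+1}^{T}x_{t+1}$ be the average of the last $n$ iterates. Then there is an absolute constant $C>0$ (independent of all the data above) such that the following hold. 1. If $\eta_t=\eta$ for all $t$, with $\eta>0$, and $T\ge 2(n-1)$, then for every $z\in\mathbb{R}^d$ $$\mathbb{E}\big[F(x^{\mathrm{suffix}}_{T+1})-F(z)\big]\le C\left(\frac{\|z-x_1\|^2}{\eta T}+\eta\sqrt n\,G_{f,1}G_{f,2}(1+\log T)\right).$$ 2. If $\eta_t=\eta/\sqrt t$ for all $t$, with $\eta>0$, then for every $z\in\mathbb{R}^d$ $$\mathbb{E}\big[F(x^{\mathrm{suffix}}_{T+1})-F(z)\big]\le C\left(\frac{\|z-x_1\|^2}{\eta}+\eta\sqrt n\,G_{f,1}G_{f,2}(1+\log T)\right)\frac1{\sqrt T}.$$ 3. If $F$ attains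 its minimum $F_*=\inf F$ at a point $x_*\ne x_1$, $D_*=\|x_*-x_1\|$, and $\eta_t=\eta/\sqrt t$ for all $t$ with $\eta=\dfrac{D_*}{n^{1/4}\sqrt{G_{f,1}G_{f,2}}}$, then $$\mathbb{E}\big[F(x^{\mathrm{suffix}}_{T+1})-F_*\big]\le C\,\frac{n^{1/4}\sqrt{G_{f,1}G_{f,2}}\,D_*\,(1+\log T)}{\sqrt T}.$$ -/

import Mathlib

open MeasureTheory ProbabilityTheory
open scoped NNReal Nat InnerProductSpace

noncomputable section

namespace ShuffledProx

/-- The Euclidean space `ℝ^d`. -/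
abbrev E (d : ℕ) : Type := EuclideanSpace ℝ (Fin d)

/-- The effective domain `{x | ψ x < +∞}` of an extended-real-valued function. -/
def dom {d : ℕ} (ψ : E d → EReal) : Set (E d) := {x | ψ x < ⊤}

/-- `ψ : ℝ^d → (-∞, +∞]` is proper, closed and convex. Convexity is that of the epigraph and
closedness is lower semicontinuity. -/
structure ProperClosedConvex {d : ℕ} (ψ : E d → EReal) : Prop where
  ne_bot : ∀ x, ψ x ≠ ⊥
  proper : (dom ψ).Nonempty
  closed : LowerSemicontinuous ψ
  convex : Convex ℝ {p : E d × ℝ | ψ p.1 ≤ (p.2 : EReal)}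

/-- The subdifferential at `x` of a real-valued function on `ℝ^d`. -/
def subdifferential {d : ℕ} (h : E d → ℝ) (x : E d) : Set (E d) :=
  {v | ∀ y, h x + ⟪v, y - x⟫_ℝ ≤ h y}

/-- The finite-sum part `f = (1/n) ∑ i, f i`. -/
def avgFun {d n : ℕ} (f : Fin n → E d → ℝ) (x : E d) : ℝ := (1 / (n : ℝ)) * ∑ i, f i x

/-- The objective `F = f + ψ`, with values in `(-∞, +∞]`. -/
def objective {d n : ℕ} (f : Fin n → E d → ℝ) (ψ : E d → EReal) (x : E d) : EReal :=
  (avgFun f x : EReal) + ψ x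

/-- The arithmetic mean of the Lipschitz constants. -/
def G1 {n : ℕ} (G : Fin n → ℝ≥0) : ℝ := (1 / (n : ℝ)) * ∑ i, (G i : ℝ)

/-- The root mean square of the Lipschitz constants. -/
def G2 {n : ℕ} (G : Fin n → ℝ≥0) : ℝ := √((1 / (n : ℝ)) * ∑ i, (G i : ℝ) ^ 2)

/-- The minimizers over `ℝ^d` of `y ↦ ψ y + ⟨v, y⟩ + ‖y - x‖² / (2η)`. -/
def proxStep {d : ℕ} (ψ : E d → EReal) (v x : E d) (η : ℝ) : Set (E d) :=
  {u | IsMinOn (fun y => ψ y + ((⟪v, y⟫_ℝ + ‖y - x‖ ^ 2 / (2 * η) : ℝ) : EReal)) Set.univ u}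

/-- `x 1, …, x (T + 1)` are the iterates of the general proximal gradient method from `x₁`, with
stepsizes `η 1, …, η T`, processed indices `I 1, …, I T`, and subgradient `g i y` of `f i` at `y`. -/
structure IsProxRun {d n : ℕ} (ψ : E d → EReal) (g : Fin n → E d → E d) (T : ℕ) (η : ℕ → ℝ)
    (I : ℕ → Fin n) (x₁ : E d) (x : ℕ → E d) : Prop where
  init : x 1 = x₁
  step : ∀ t ∈ Finset.Icc 1 T, x (t + 1) ∈ proxStep ψ (g (I t) (x t)) (x t) (η t)

/-- The permutations `π 0, …, π (⌈T/n⌉ - 1)` are mutually independent random permutations, each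
uniformly distributed on the symmetric group of the index set; `π k` is used in epoch `k + 1`.
Permutations with larger `k` are not used. -/
structure IsReshuffle {n : ℕ} (T : ℕ) {Ω : Type*} [MeasurableSpace Ω] (μ : Measure Ω)
    (π : ℕ → Ω → Equiv.Perm (Fin n)) : Prop where
  measurable : ∀ k < T ⌈/⌉ n, Measurable[_, ⊤] (π k)
  indep : iIndepFun (m := fun _ => ⊤) (fun (k : Fin (T ⌈/⌉ n)) => π k) μ
  uniform : ∀ k < T ⌈/⌉ n, ∀ σ : Equiv.Perm (Fin n), μ.real {ω | π k ω = σ} = 1 / (n ! : ℝ)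

/-- The Random Reshuffle index at time `t ≥ 1`. Epochs and positions inside an epoch are counted
from `0`, so time `t` is position `(t - 1) % n` of epoch `(t - 1) / n`. -/
def rrIndex {n : ℕ} [NeZero n] {Ω : Type*} (π : ℕ → Ω → Equiv.Perm (Fin n)) (ω : Ω) (t : ℕ) :
    Fin n :=
  π ((t - 1) / n) ω (Fin.ofNat n (t - 1))

/-- The suffix average `(1/n) ∑_{t = T-n+1}^{T} x_{t+1}` of the last `n` iterates (for `n ≤ T`). -/
def suffixAvg {d : ℕ} (n T : ℕ) (x : ℕ → E d) : E d :=
  (1 / (n : ℝ)) • ∑ t ∈ Finset.Icc (T - n + 1) T, x (t + 1)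

/-- `𝔼[Y - r] ≤ b` for an extended-real random variable `Y`: it only takes finite values, is
integrable, and its expectation minus `r` is at most `b`. The value `r` may be `+∞`. -/
def ExpGapLE {Ω : Type*} [MeasurableSpace Ω] (μ : Measure Ω) (Y : Ω → EReal) (r : EReal) (b : ℝ) :
    Prop :=
  (∀ ω, Y ω ≠ ⊥ ∧ Y ω ≠ ⊤) ∧ Integrable (fun ω => (Y ω).toReal) μ ∧
    ((∫ ω, (Y ω).toReal ∂μ : ℝ) : EReal) - r ≤ (b : EReal)

end ShuffledProx

end

open ShuffledProx

/-!
The bounds hold because, inside an epoch, a sample drawn without replacement is almost a fresh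
uniform sample as far as the iterates can tell.

*Exchangeability.* Let `i` be the component processed at time `t` and `x` the iterate at a time
`s ≤ t`. Writing `f = (1/n) ∑ q, f (σ q)` with the permutation `σ` of the epoch of `t`, and swapping
in each summand the position `q` with the position of `t`, one sees that the expectations of `f x`
and `f i x` differ only through the effect of one swap on the iterate. A swap changes the step at
one earlier time, by a first-order amount; afterwards the two runs use the same components, and
monotonicity of subgradients together with firm nonexpansiveness of the proximal map makes the
squared distance grow by `4 η² G²` per step only (`IsProblem.norm_sq_run_sub_le`). Over an epoch
the distance is thus of order `η √n G2` instead of `η n G1`, which gives the bias bound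
`9 η √n G1 G2` in `IsProblem.abs_expect_avgFun_sub_le`. The subgradients themselves need not be
bounded: their linear forms are bounded only along the affine hull of `dom ψ`, which suffices since
all vectors involved are multiples of differences of points of `dom ψ`.

*Suffix averages.* The standard one-step inequality now holds in expectation, with an error of order
`η² √n G1 G2`, for comparison with a fixed point `z` as well as with any earlier iterate, even of
the same epoch (`IsProblem.expect_step_le`). Comparison with the iterate at time `s` limits the growth
of the `η`-weighted average of the gaps when its first term is dropped, and this descends from the
average over all times to any suffix (`IsStepsize.suffix_le`). For a constant stepsize the suffix of
length `n` is the uniform average. For `η / √t` the suffix of length one bounds every single iterate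
at rate `1 / √t`, and these bounds are averaged over the last `n` times. Convexity of `f + ψ` passes
to the averaged point.

*Probability.* Proximal steps are unique, so a run is a function of the tuple of permutations, and
every tuple occurs with the same positive probability. All expectations are therefore uniform
averages over tuples (`IsProblem.expGapLE_of_expect_le`), on which swaps act by multiplication.
-/

open ShuffledProx

namespace ShuffledProx

/-! ### Proximal steps -/

section Prox

variable {d : ℕ} {ψ : E d → EReal}

theorem ProperClosedConvex.coe_toReal (hψ : ProperClosedConvex ψ) {x : E d} (hx : x ∈ dom ψ) :
    (((ψ x).toReal : ℝ) : EReal) = ψ x :=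
  EReal.coe_toReal (ne_of_lt hx) (hψ.ne_bot x)

theorem ProperClosedConvex.convexOn (hψ : ProperClosedConvex ψ) :
    ConvexOn ℝ (dom ψ) (fun x => (ψ x).toReal) := by
  have key : ∀ x ∈ dom ψ, ∀ y ∈ dom ψ, ∀ a b : ℝ, 0 ≤ a → 0 ≤ b → a + b = 1 →
      ψ (a • x + b • y) ≤ ((a * (ψ x).toReal + b * (ψ y).toReal : ℝ) : EReal) := by
    intro x hx y hy a b ha hb hab
    have h1 : ((x, (ψ x).toReal) : E d × ℝ) ∈ {p : E d × ℝ | ψ p.1 ≤ (p.2 : EReal)} :=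
      (hψ.coe_toReal hx).ge
    have h2 : ((y, (ψ y).toReal) : E d × ℝ) ∈ {p : E d × ℝ | ψ p.1 ≤ (p.2 : EReal)} :=
      (hψ.coe_toReal hy).ge
    simpa using hψ.convex h1 h2 ha hb hab
  have hdom : Convex ℝ (dom ψ) := fun x hx y hy a b ha hb hab =>
    lt_of_le_of_lt (key x hx y hy a b ha hb hab) (EReal.coe_lt_top _)
  refine ⟨hdom, fun x hx y hy a b ha hb hab => ?_⟩
  have := key x hx y hy a b ha hb hab
  rw [← hψ.coe_toReal (hdom hx hy ha hb hab)] at this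
  simpa using EReal.coe_le_coe_iff.1 this

theorem proxStep_le {x u v : E d} {η : ℝ} (hu : u ∈ proxStep ψ v x η) (y : E d) :
    ψ u + ((⟪v, u⟫_ℝ + ‖u - x‖ ^ 2 / (2 * η) : ℝ) : EReal)
      ≤ ψ y + ((⟪v, y⟫_ℝ + ‖y - x‖ ^ 2 / (2 * η) : ℝ) : EReal) :=
  hu (Set.mem_univ y)

theorem proxStep_subset_dom {x y u v : E d} {η : ℝ} (hy : y ∈ dom ψ)
    (hu : u ∈ proxStep ψ v x η) : u ∈ dom ψ := by
  by_contra h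
  have h1 : ψ u = ⊤ := not_lt_top_iff.1 h
  have h2 := proxStep_le hu y
  simp only [h1, EReal.top_add_coe, top_le_iff] at h2
  exact EReal.add_ne_top (ne_of_lt hy) (EReal.coe_ne_top _) h2

/-- The variational inequality of the proximal step: the value of the linearized objective
at the output `u` beats the one at any `z`, up to the quadratic regularizer. -/
theorem proxStep_inner_le (hψ : ProperClosedConvex ψ) {x u v z : E d} {η : ℝ} (hη : 0 < η)
    (hu : u ∈ proxStep ψ v x η) (hz : z ∈ dom ψ) :
    (ψ u).toReal - (ψ z).toReal + ⟪v, u - z⟫_ℝ ≤ ⟪u - x, z - u⟫_ℝ / η := by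
  have hud : u ∈ dom ψ := proxStep_subset_dom hz hu
  -- first-order optimality along the segment from `u` to `z`
  have seg : ∀ a : ℝ, 0 < a → a < 1 →
      (ψ u).toReal - (ψ z).toReal + ⟪v, u - z⟫_ℝ - ⟪u - x, z - u⟫_ℝ / η
        ≤ a * (‖z - u‖ ^ 2 / (2 * η)) := by
    intro a ha ha1
    have hc := hψ.convexOn.2 hud hz (by linarith : 0 ≤ 1 - a) ha.le (by ring)
    have hcd := hψ.convexOn.1 hud hz (by linarith : 0 ≤ 1 - a) ha.le (by ring)
    have hm := proxStep_le hu ((1 - a) • u + a • z)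
    rw [← hψ.coe_toReal hud, ← hψ.coe_toReal hcd, ← EReal.coe_add, ← EReal.coe_add,
      EReal.coe_le_coe_iff] at hm
    have e1 : (1 - a) • u + a • z = u + a • (z - u) := by module
    have e2 : u + a • (z - u) - x = (u - x) + a • (z - u) := by module
    simp only [e1, smul_eq_mul] at hm hc
    rw [e2, norm_add_sq_real, inner_add_right, inner_smul_right, inner_smul_right, norm_smul,
      Real.norm_eq_abs, mul_pow, sq_abs] at hm
    have e3 : ⟪v, u - z⟫_ℝ = - ⟪v, z - u⟫_ℝ := by rw [← inner_neg_right]; congr 1; abel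
    rw [e3]
    refine le_of_mul_le_mul_left ?_ ha
    have e4 : (‖u - x‖ ^ 2 + 2 * (a * ⟪u - x, z - u⟫_ℝ) + a ^ 2 * ‖z - u‖ ^ 2) / (2 * η)
        = ‖u - x‖ ^ 2 / (2 * η) + a * (⟪u - x, z - u⟫_ℝ / η)
          + a * (a * (‖z - u‖ ^ 2 / (2 * η))) := by
      field_simp
    rw [e4] at hm
    linarith
  rw [← sub_nonpos]
  refine le_of_forall_pos_le_add fun ε hε => ?_
  set R := ‖z - u‖ ^ 2 / (2 * η) with hR
  have hR0 : 0 ≤ R := by positivity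
  have hs := seg (min (1 / 2) (ε / (R + 1))) (by positivity)
    (lt_of_le_of_lt (min_le_left _ _) (by norm_num))
  refine hs.trans ?_
  have : min (1 / 2) (ε / (R + 1)) * R ≤ ε / (R + 1) * (R + 1) := by
    gcongr
    · exact min_le_right _ _
    · linarith
  rw [div_mul_cancel₀ _ (by positivity)] at this
  linarith

/-- Firm nonexpansiveness of the proximal step. -/
theorem proxStep_firm (hψ : ProperClosedConvex ψ) {x x' u u' v v' : E d} {η : ℝ} (hη : 0 < η)
    (hud : u ∈ dom ψ) (hu : u ∈ proxStep ψ v x η) (hu' : u' ∈ proxStep ψ v' x' η) :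
    ‖u - u'‖ ^ 2 ≤ ⟪x - x', u - u'⟫_ℝ - η * ⟪v - v', u - u'⟫_ℝ := by
  have h1 := proxStep_inner_le hψ hη hu (proxStep_subset_dom hud hu')
  have h2 := proxStep_inner_le hψ hη hu' hud
  have h3 := add_le_add h1 h2
  rw [← add_div, le_div_iff₀ hη] at h3
  have e1 : ⟪v', u' - u⟫_ℝ = - ⟪v', u - u'⟫_ℝ := by rw [← inner_neg_right]; congr 1; abel
  have e2 : ⟪u - x, u' - u⟫_ℝ = - ⟪u - x, u - u'⟫_ℝ := by rw [← inner_neg_right]; congr 1; abel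
  have e3 : ‖u - u'‖ ^ 2 = ⟪u - x, u - u'⟫_ℝ + ⟪x - x', u - u'⟫_ℝ - ⟪u' - x', u - u'⟫_ℝ := by
    rw [← real_inner_self_eq_norm_sq, ← inner_add_left, ← inner_sub_left]; congr 1; abel
  rw [e1, e2] at h3
  rw [e3, inner_sub_left v]
  linarith

theorem proxStep_unique (hψ : ProperClosedConvex ψ) {x u u' v : E d} {η : ℝ} (hη : 0 < η)
    (hud : u ∈ dom ψ) (hu : u ∈ proxStep ψ v x η) (hu' : u' ∈ proxStep ψ v x η) : u = u' := by
  have h := proxStep_firm hψ hη hud hu hu'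
  simp only [sub_self, inner_zero_left, mul_zero] at h
  have : ‖u - u'‖ = 0 := by nlinarith [norm_nonneg (u - u')]
  exact sub_eq_zero.1 (norm_eq_zero.1 this)

end Prox

/-- The standing assumptions on the components `f i`, the regularizer `ψ`, the Lipschitz
constants `G i` and the subgradient oracle `g`. -/
structure IsProblem {d n : ℕ} (f : Fin n → E d → ℝ) (ψ : E d → EReal) (G : Fin n → ℝ≥0)
    (g : Fin n → E d → E d) : Prop where
  convex_f : ∀ i, ConvexOn ℝ Set.univ (f i)
  convex_ψ : ProperClosedConvex ψ
  pos : ∀ i, 0 < G i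
  lipschitz : ∀ i, LipschitzOnWith (G i) (f i) (dom ψ)
  subgradient : ∀ i y, g i y ∈ subdifferential (f i) y
  lipschitz_inner : ∀ i, ∀ y ∈ dom ψ, LipschitzOnWith (G i) (fun u => ⟪g i y, u⟫_ℝ) (dom ψ)

namespace IsProblem

variable {d n : ℕ} {f : Fin n → E d → ℝ} {ψ : E d → EReal} {G : Fin n → ℝ≥0}
  {g : Fin n → E d → E d}

theorem abs_sub_le (hP : IsProblem f ψ G g) (i : Fin n) {x y : E d} (hx : x ∈ dom ψ)
    (hy : y ∈ dom ψ) : |f i x - f i y| ≤ G i * ‖x - y‖ := by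
  simpa [Real.dist_eq, dist_eq_norm] using (hP.lipschitz i).dist_le_mul x hx y hy

theorem abs_inner_le (hP : IsProblem f ψ G g) (i : Fin n) {x p q : E d} (hx : x ∈ dom ψ)
    (hp : p ∈ dom ψ) (hq : q ∈ dom ψ) : |⟪g i x, p - q⟫_ℝ| ≤ G i * ‖p - q‖ := by
  simpa [Real.dist_eq, dist_eq_norm, inner_sub_right] using
    (hP.lipschitz_inner i x hx).dist_le_mul p hp q hq

/-- The bound of `abs_inner_le` persists for differences of two differences of points of
`dom ψ`, since by convexity these are multiples of differences of two points of `dom ψ`. -/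
theorem abs_inner_sub_le (hP : IsProblem f ψ G g) (i : Fin n) {x p q p' q' : E d}
    (hx : x ∈ dom ψ) (hp : p ∈ dom ψ) (hq : q ∈ dom ψ) (hp' : p' ∈ dom ψ) (hq' : q' ∈ dom ψ) :
    |⟪g i x, (p - q) - (p' - q')⟫_ℝ| ≤ G i * ‖(p - q) - (p' - q')‖ := by
  have hc := hP.convex_ψ.convexOn.1
  have e : (p - q) - (p' - q') = (2 : ℝ) • (((1 / 2 : ℝ) • p + (1 / 2 : ℝ) • q')
      - ((1 / 2 : ℝ) • q + (1 / 2 : ℝ) • p')) := by module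
  have h2 : (0 : ℝ) ≤ 1 / 2 := by norm_num
  have h := hP.abs_inner_le i hx (hc hp hq' h2 h2 (by norm_num)) (hc hq hp' h2 h2 (by norm_num))
  rw [e, inner_smul_right, norm_smul, abs_mul, Real.norm_eq_abs, mul_left_comm]
  exact mul_le_mul_of_nonneg_left h (abs_nonneg _)

theorem inner_sub_nonneg (hP : IsProblem f ψ G g) (i : Fin n) (x y : E d) :
    0 ≤ ⟪x - y, g i x - g i y⟫_ℝ := by
  have h1 := hP.subgradient i x y
  have h2 := hP.subgradient i y x
  have e : ⟪g i x, y - x⟫_ℝ = - ⟪g i x, x - y⟫_ℝ := by rw [← inner_neg_right]; congr 1; abel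
  rw [e] at h1
  rw [real_inner_comm, inner_sub_left]
  linarith

/-- Two proximal steps with the same component: monotonicity of the subgradient makes the step
nonexpansive up to a second-order term. -/
theorem norm_sq_step_le (hP : IsProblem f ψ G g) (i : Fin n) {x x' u u' : E d} {η : ℝ}
    (hη : 0 < η) (hx : x ∈ dom ψ) (hx' : x' ∈ dom ψ) (hu : u ∈ proxStep ψ (g i x) x η)
    (hu' : u' ∈ proxStep ψ (g i x') x' η) :
    ‖u - u'‖ ^ 2 ≤ ‖x - x'‖ ^ 2 + 4 * η ^ 2 * (G i : ℝ) ^ 2 := by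
  have hud := proxStep_subset_dom hx hu
  have hud' := proxStep_subset_dom hx hu'
  have h := proxStep_firm hP.convex_ψ hη hud hu hu'
  have hmono := hP.inner_sub_nonneg i x x'
  have hA := hP.abs_inner_sub_le i hx hud hud' hx hx'
  have hB := hP.abs_inner_sub_le i hx' hud hud' hx hx'
  set a := x - x' with ha
  set b := u - u' with hb
  set h1 := g i x
  set h2 := g i x'
  have e1 : ⟪h1 - h2, b⟫_ℝ = ⟪a, h1 - h2⟫_ℝ + (⟪h1, b - a⟫_ℝ - ⟪h2, b - a⟫_ℝ) := by
    rw [real_inner_comm (h1 - h2) a, ← inner_sub_left, ← inner_add_right]; congr 1; abel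
  have e2 : ‖b - a‖ ^ 2 = ‖b‖ ^ 2 - 2 * ⟪a, b⟫_ℝ + ‖a‖ ^ 2 := by
    rw [norm_sub_sq_real, real_inner_comm]
  rw [e1] at h
  have h3 := (abs_le.1 hA).1
  have h4 := (abs_le.1 hB).2
  have h5 : η * (-(2 * G i * ‖b - a‖)) ≤ η * (⟪a, h1 - h2⟫_ℝ + (⟪h1, b - a⟫_ℝ - ⟪h2, b - a⟫_ℝ)) :=
    mul_le_mul_of_nonneg_left (by linarith) hη.le
  nlinarith [sq_nonneg (‖b - a‖ - 2 * η * G i)]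

/-- Two proximal steps with different components. -/
theorem norm_step_le (hP : IsProblem f ψ G g) (i j : Fin n) {x x' u u' : E d} {η : ℝ}
    (hη : 0 < η) (hx : x ∈ dom ψ) (hx' : x' ∈ dom ψ) (hu : u ∈ proxStep ψ (g i x) x η)
    (hu' : u' ∈ proxStep ψ (g j x') x' η) :
    ‖u - u'‖ ≤ ‖x - x'‖ + η * (G i + G j) := by
  have hud := proxStep_subset_dom hx hu
  have hud' := proxStep_subset_dom hx hu'
  have h := proxStep_firm hP.convex_ψ hη hud hu hu'
  have hA := (abs_le.1 (hP.abs_inner_le i hx hud hud')).1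
  have hB := (abs_le.1 (hP.abs_inner_le j hx' hud hud')).2
  have hC := real_inner_le_norm (x - x') (u - u')
  rw [inner_sub_left (g i x)] at h
  have h5 : η * (-((G i + G j) * ‖u - u'‖)) ≤ η * (⟪g i x, u - u'⟫_ℝ - ⟪g j x', u - u'⟫_ℝ) :=
    mul_le_mul_of_nonneg_left (by linarith) hη.le
  by_contra! hlt
  have : 0 < ‖u - u'‖ := lt_of_le_of_lt (by positivity) hlt
  nlinarith

/-- The basic inequality of one step with component `i`, compared with a point `z`. -/
theorem step_le (hP : IsProblem f ψ G g) (i : Fin n) {x u z : E d} {η : ℝ}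
    (hη : 0 < η) (hx : x ∈ dom ψ) (hz : z ∈ dom ψ) (hu : u ∈ proxStep ψ (g i x) x η) :
    (avgFun f u + (ψ u).toReal) - (avgFun f x - f i x) - (f i z + (ψ z).toReal)
      ≤ (‖z - x‖ ^ 2 - ‖z - u‖ ^ 2) / (2 * η) + η * ((G i : ℝ) ^ 2 + G1 G ^ 2) := by
  have hud := proxStep_subset_dom hx hu
  have h1 := proxStep_inner_le hP.convex_ψ hη hu hz
  have h2 := hP.subgradient i x z
  have h3 := (abs_le.1 (hP.abs_inner_le i hx hud hx)).1
  have h4 : avgFun f u - avgFun f x ≤ G1 G * ‖u - x‖ := by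
    rw [avgFun, avgFun, G1, ← mul_sub, ← Finset.sum_sub_distrib, mul_assoc, Finset.sum_mul]
    gcongr with j _
    exact (le_abs_self _).trans (hP.abs_sub_le j hud hx)
  have e1 : ⟪g i x, u - z⟫_ℝ = ⟪g i x, u - x⟫_ℝ - ⟪g i x, z - x⟫_ℝ := by
    rw [← inner_sub_right]; congr 1; abel
  have e2 : ⟪u - x, z - u⟫_ℝ = (‖z - x‖ ^ 2 - ‖z - u‖ ^ 2 - ‖u - x‖ ^ 2) / 2 := by
    have : z - x = (z - u) + (u - x) := by abel
    rw [this, norm_add_sq_real, real_inner_comm]; ring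
  rw [e1, e2] at h1
  have e3 : (‖z - x‖ ^ 2 - ‖z - u‖ ^ 2 - ‖u - x‖ ^ 2) / 2 / η
      = (‖z - x‖ ^ 2 - ‖z - u‖ ^ 2) / (2 * η) - ‖u - x‖ ^ 2 / (2 * η) := by field_simp
  rw [e3] at h1
  have h5 : (G i + G1 G) * ‖u - x‖ ≤ ‖u - x‖ ^ 2 / (2 * η) + η * ((G i : ℝ) ^ 2 + G1 G ^ 2) := by
    rw [← sub_le_iff_le_add, le_div_iff₀ (by positivity)]
    nlinarith [sq_nonneg (‖u - x‖ - η * (G i + G1 G)), mul_nonneg (sq_nonneg η)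
      (sq_nonneg ((G i : ℝ) - G1 G))]
  linarith

end IsProblem

/-! ### Stability of runs -/

namespace IsProblem

variable {d n : ℕ} {f : Fin n → E d → ℝ} {ψ : E d → EReal} {G : Fin n → ℝ≥0}
  {g : Fin n → E d → E d} {T : ℕ} {η : ℕ → ℝ} {I I' : ℕ → Fin n} {x₁ : E d} {x x' : ℕ → E d}

theorem mem_dom_of_run (hx₁ : x₁ ∈ dom ψ) (hx : IsProxRun ψ g T η I x₁ x) {t : ℕ} (h1 : 1 ≤ t)
    (hT : t ≤ T + 1) : x t ∈ dom ψ := by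
  rcases Nat.eq_or_lt_of_le h1 with rfl | h
  · rwa [hx.init]
  · obtain ⟨s, rfl⟩ : ∃ s, t = s + 1 := ⟨t - 1, by omega⟩
    exact proxStep_subset_dom hx₁ (hx.step s (Finset.mem_Icc.2 ⟨by omega, by omega⟩))

theorem run_eq (hP : IsProblem f ψ G g) (hη : ∀ t, 1 ≤ t → 0 < η t) (hx₁ : x₁ ∈ dom ψ)
    (hx : IsProxRun ψ g T η I x₁ x) (hx' : IsProxRun ψ g T η I' x₁ x') {s : ℕ} (h1 : 1 ≤ s)
    (hT : s ≤ T + 1) (hI : ∀ t, 1 ≤ t → t < s → I t = I' t) : x s = x' s := by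
  induction s, h1 using Nat.le_induction with
  | base => rw [hx.init, hx'.init]
  | succ s hs ih =>
    have hxs := ih (by omega) (fun t h1 h2 => hI t h1 (by omega))
    have h1 := hx.step s (Finset.mem_Icc.2 ⟨hs, by omega⟩)
    have h2 := hx'.step s (Finset.mem_Icc.2 ⟨hs, by omega⟩)
    rw [← hxs, ← hI s hs (by omega)] at h2
    exact proxStep_unique hP.convex_ψ (hη s hs) (proxStep_subset_dom hx₁ h1) h1 h2

/-- Two runs whose indices before time `s` differ at time `a` only stay close: the perturbation
at time `a` is of first order, but it grows afterwards only by the square root of the sum of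
squared step lengths. -/
theorem norm_sq_run_sub_le (hP : IsProblem f ψ G g) (hη : ∀ t, 1 ≤ t → 0 < η t)
    (hx₁ : x₁ ∈ dom ψ) (hx : IsProxRun ψ g T η I x₁ x) (hx' : IsProxRun ψ g T η I' x₁ x')
    {a s : ℕ} (ha : 1 ≤ a) (has : a < s) (hT : s ≤ T + 1)
    (hI : ∀ t, 1 ≤ t → t < s → t ≠ a → I t = I' t) :
    ‖x s - x' s‖ ^ 2 ≤ (η a * (G (I a) + G (I' a))) ^ 2
      + ∑ t ∈ Finset.Ioo a s, 4 * η t ^ 2 * (G (I t) : ℝ) ^ 2 := by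
  induction s, (Nat.succ_le_of_lt has) using Nat.le_induction with
  | base =>
    have hxa : x a = x' a := hP.run_eq hη hx₁ hx hx' ha (by omega)
      (fun t h1 h2 => hI t h1 (by omega) h2.ne)
    have h := hP.norm_step_le (I a) (I' a) (hη a ha) (mem_dom_of_run hx₁ hx ha (by omega))
      (mem_dom_of_run hx₁ hx' ha (by omega)) (hx.step a (Finset.mem_Icc.2 ⟨ha, by omega⟩))
      (hx'.step a (Finset.mem_Icc.2 ⟨ha, by omega⟩))
    rw [hxa, sub_self, norm_zero, zero_add] at h
    have e : Finset.Ioo a (a + 1) = ∅ := by ext; simp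
    simpa [e] using pow_le_pow_left₀ (norm_nonneg _) h 2
  | succ s hs ih =>
    have hs' : a < s := hs
    have hxs := ih hs' (by omega) (fun t h1 h2 => hI t h1 (by omega))
    have h2 := hx'.step s (Finset.mem_Icc.2 ⟨by omega, by omega⟩)
    rw [← hI s (by omega) (by omega) (by omega)] at h2
    have h := hP.norm_sq_step_le (I s) (hη s (by omega))
      (mem_dom_of_run hx₁ hx (by omega) (by omega)) (mem_dom_of_run hx₁ hx' (by omega) (by omega))
      (hx.step s (Finset.mem_Icc.2 ⟨by omega, by omega⟩)) h2
    have e : Finset.Ioo a (s + 1) = insert s (Finset.Ioo a s) := by ext; simp; omega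
    rw [e, Finset.sum_insert (by simp)]
    linarith

end IsProblem

/-! ### Stepsizes -/

/-- The properties of the stepsizes on which the analysis rests: `η t` is positive and
nonincreasing while `√t * η t` is nondecreasing. Both `η` and `η / √t` qualify. -/
structure IsStepsize (η : ℕ → ℝ) : Prop where
  pos : ∀ t, 1 ≤ t → 0 < η t
  anti : ∀ s t, 1 ≤ s → s ≤ t → η t ≤ η s
  mono : ∀ s t, 1 ≤ s → s ≤ t → s * η s ^ 2 ≤ t * η t ^ 2

theorem sum_inv_sqrt_le (a m : ℕ) :
    ∑ q ∈ Finset.range m, 1 / √((a + q + 1 : ℕ) : ℝ) ≤ 2 * m / √((a + m : ℕ) : ℝ) := by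
  have h1 : ∑ q ∈ Finset.range m, 1 / √((a + q + 1 : ℕ) : ℝ)
      ≤ 2 * (√((a + m : ℕ) : ℝ) - √(a : ℝ)) := by
    induction m with
    | zero => simp
    | succ m ih =>
      rw [Finset.sum_range_succ]
      have hpos : 0 < √((a + m + 1 : ℕ) : ℝ) := by positivity
      have : 1 / √((a + m + 1 : ℕ) : ℝ) ≤ 2 * (√((a + m + 1 : ℕ) : ℝ) - √((a + m : ℕ) : ℝ)) := by
        rw [div_le_iff₀ hpos]
        have e1 := Real.sq_sqrt (Nat.cast_nonneg (α := ℝ) (a + m + 1))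
        have e2 := Real.sq_sqrt (Nat.cast_nonneg (α := ℝ) (a + m))
        have e3 : ((a + m + 1 : ℕ) : ℝ) = ((a + m : ℕ) : ℝ) + 1 := by push_cast; ring
        nlinarith [sq_nonneg (√((a + m + 1 : ℕ) : ℝ) - √((a + m : ℕ) : ℝ))]
      have e : a + (m + 1) = a + m + 1 := by ring
      rw [e]
      linarith
  rcases Nat.eq_zero_or_pos m with rfl | hm
  · simp
  refine h1.trans ?_
  have hpos : 0 < √((a + m : ℕ) : ℝ) := Real.sqrt_pos.2 (by exact_mod_cast (by omega : 0 < a + m))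
  rw [le_div_iff₀ hpos]
  have e1 := Real.sq_sqrt (Nat.cast_nonneg (α := ℝ) (a + m))
  have e2 := Real.sq_sqrt (Nat.cast_nonneg (α := ℝ) a)
  have e3 : √(a : ℝ) ≤ √((a + m : ℕ) : ℝ) := Real.sqrt_le_sqrt (by push_cast; simp)
  have e4 : ((a + m : ℕ) : ℝ) = (a : ℝ) + m := by push_cast; ring
  nlinarith [Real.sqrt_nonneg (a : ℝ)]

theorem IsStepsize.le_mul_inv_sqrt {η : ℕ → ℝ} (hη : IsStepsize η) {s t : ℕ} (hs : 1 ≤ s)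
    (hst : s ≤ t) : η s ≤ η t * √(t : ℝ) * (1 / √(s : ℝ)) := by
  have h := hη.mono s t hs hst
  have hs0 : 0 < √(s : ℝ) := Real.sqrt_pos.2 (by exact_mod_cast hs)
  rw [mul_one_div, le_div_iff₀ hs0]
  have ht := hη.pos t (hs.trans hst)
  refine le_of_sq_le_sq ?_ (by positivity)
  rw [mul_pow, mul_pow, Real.sq_sqrt (by positivity), Real.sq_sqrt (by positivity)]
  linarith

/-- The stepsizes inside an epoch, from its start to the position `r`, sum to at most `2n` times
the current one. -/
theorem IsStepsize.sum_epoch_le {η : ℕ → ℝ} (hη : IsStepsize η) {n : ℕ} (a : ℕ) (r : Fin n) :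
    ∑ q ∈ Finset.Iio r, η (a + q + 1) ≤ 2 * n * η (a + r + 1) := by
  have ht := hη.pos (a + r + 1) (by omega)
  have e : ∑ q ∈ Finset.Iio r, η (a + q + 1) = ∑ q ∈ Finset.range r, η (a + q + 1) := by
    rw [← Nat.Iio_eq_range, ← Fin.map_valEmbedding_Iio, Finset.sum_map]; rfl
  rw [e]
  calc ∑ q ∈ Finset.range r, η (a + q + 1)
      ≤ ∑ q ∈ Finset.range (r + 1), η (a + q + 1) :=
        Finset.sum_le_sum_of_subset_of_nonneg (Finset.range_mono (by omega))
          fun q _ _ => (hη.pos _ (by omega)).le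
    _ ≤ ∑ q ∈ Finset.range (r + 1), η (a + r + 1) * √((a + r + 1 : ℕ) : ℝ)
          * (1 / √((a + q + 1 : ℕ) : ℝ)) := by
        refine Finset.sum_le_sum fun q hq => hη.le_mul_inv_sqrt (by omega) ?_
        have := Finset.mem_range.1 hq
        omega
    _ ≤ η (a + r + 1) * √((a + r + 1 : ℕ) : ℝ) * (2 * (r + 1 : ℕ) / √((a + (r + 1) : ℕ) : ℝ)) := by
        rw [← Finset.mul_sum]
        exact mul_le_mul_of_nonneg_left (sum_inv_sqrt_le a (r + 1)) (by positivity)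
    _ = 2 * (r + 1 : ℕ) * η (a + r + 1) := by
        rw [← add_assoc a]
        have : √((a + r + 1 : ℕ) : ℝ) ≠ 0 := by positivity
        field_simp
    _ ≤ 2 * n * η (a + r + 1) := by
        have : ((r + 1 : ℕ) : ℝ) ≤ n := by exact_mod_cast r.2
        gcongr

/-- Summing over the position `q` of the perturbation keeps the sum of squared stepsizes below
`n² η²` for the current `η`, without a logarithmic factor even in the first epoch. -/
theorem IsStepsize.sum_sum_sq_epoch_le {η : ℕ → ℝ} (hη : IsStepsize η) {n : ℕ} (a : ℕ)
    (r : Fin n) :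
    ∑ q ∈ Finset.Iio r, ∑ p ∈ Finset.Ioo q r, η (a + p + 1) ^ 2
      ≤ (n : ℝ) ^ 2 * η (a + r + 1) ^ 2 := by
  rw [Finset.sum_comm' (t' := Finset.Iio r) (s' := fun p => Finset.Iio p)
    (by intro q p; simp only [Finset.mem_Iio, Finset.mem_Ioo]; constructor
        · rintro ⟨-, h1, h2⟩; exact ⟨h1, h2⟩
        · rintro ⟨h1, h2⟩; exact ⟨h1.trans h2, h1, h2⟩)]
  have hp : ∀ p ∈ Finset.Iio r, ∑ q ∈ Finset.Iio p, η (a + p + 1) ^ 2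
      ≤ n * η (a + r + 1) ^ 2 := by
    intro p hp
    have hpr : (p : ℕ) < r := Fin.lt_def.1 (Finset.mem_Iio.1 hp)
    rw [Finset.sum_const, Fin.card_Iio, nsmul_eq_mul]
    have h := hη.mono (a + p + 1) (a + r + 1) (by omega) (by omega)
    have h2 : ((p : ℕ) : ℝ) * ((a + r + 1 : ℕ) : ℝ) ≤ n * ((a + p + 1 : ℕ) : ℝ) := by
      have hr := r.2
      exact_mod_cast (by nlinarith : (p : ℕ) * (a + r + 1) ≤ n * (a + p + 1))
    have h3 : (0 : ℝ) < ((a + p + 1 : ℕ) : ℝ) := by positivity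
    refine le_of_mul_le_mul_left ?_ h3
    calc ((a + p + 1 : ℕ) : ℝ) * ((p : ℕ) * η (a + p + 1) ^ 2)
        = (p : ℕ) * (((a + p + 1 : ℕ) : ℝ) * η (a + p + 1) ^ 2) := by ring
      _ ≤ (p : ℕ) * (((a + r + 1 : ℕ) : ℝ) * η (a + r + 1) ^ 2) := by gcongr
      _ = ((p : ℕ) * ((a + r + 1 : ℕ) : ℝ)) * η (a + r + 1) ^ 2 := by ring
      _ ≤ (n * ((a + p + 1 : ℕ) : ℝ)) * η (a + r + 1) ^ 2 := by gcongr
      _ = _ := by ring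
  refine (Finset.sum_le_sum hp).trans ?_
  rw [Finset.sum_const, Fin.card_Iio, nsmul_eq_mul]
  have : ((r : ℕ) : ℝ) ≤ n := by exact_mod_cast r.2.le
  rw [sq (n : ℝ), mul_assoc]
  gcongr

/-! ### Means of the Lipschitz constants -/

section Means

variable {n : ℕ} (G : Fin n → ℝ≥0)

theorem G1_nonneg : 0 ≤ G1 G := by unfold G1; positivity

theorem G2_nonneg : 0 ≤ G2 G := Real.sqrt_nonneg _

theorem G2_sq : G2 G ^ 2 = (1 / (n : ℝ)) * ∑ i, (G i : ℝ) ^ 2 :=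
  Real.sq_sqrt (by positivity)

theorem G1_pos [NeZero n] (hG : ∀ i, 0 < G i) : 0 < G1 G := by
  unfold G1
  have : 0 < ∑ i, (G i : ℝ) := Finset.sum_pos (fun i _ => hG i) Finset.univ_nonempty
  have : 0 < (n : ℝ) := by exact_mod_cast Nat.pos_of_neZero n
  positivity

theorem G1_le_G2 [NeZero n] : G1 G ≤ G2 G := by
  have hn : 0 < (n : ℝ) := by exact_mod_cast Nat.pos_of_neZero n
  refine le_of_sq_le_sq ?_ (G2_nonneg G)
  rw [G2_sq, G1, mul_pow]
  have h := sq_sum_le_card_mul_sum_sq (s := Finset.univ) (f := fun i => (G i : ℝ))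
  rw [Finset.card_univ, Fintype.card_fin] at h
  calc (1 / (n : ℝ)) ^ 2 * (∑ i, (G i : ℝ)) ^ 2
      ≤ (1 / (n : ℝ)) ^ 2 * (n * ∑ i, (G i : ℝ) ^ 2) := by gcongr
    _ = _ := by field_simp

theorem G2_le_sqrt_mul_G1 [NeZero n] : G2 G ≤ √n * G1 G := by
  have hn : 0 < (n : ℝ) := by exact_mod_cast Nat.pos_of_neZero n
  refine le_of_sq_le_sq ?_ (by have := G1_nonneg G; positivity)
  rw [G2_sq, G1, mul_pow, Real.sq_sqrt hn.le, mul_pow]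
  have h : ∑ i, (G i : ℝ) ^ 2 ≤ (∑ i, (G i : ℝ)) ^ 2 :=
    Finset.sum_sq_le_sq_sum_of_nonneg fun i _ => (G i).2
  calc 1 / (n : ℝ) * ∑ i, (G i : ℝ) ^ 2 ≤ 1 / (n : ℝ) * (∑ i, (G i : ℝ)) ^ 2 := by gcongr
    _ = _ := by field_simp

theorem G2_sq_le [NeZero n] : G2 G ^ 2 ≤ √n * G1 G * G2 G := by
  rw [sq]; exact mul_le_mul_of_nonneg_right (G2_le_sqrt_mul_G1 G) (G2_nonneg G)

theorem G1_sq_le [NeZero n] : G1 G ^ 2 ≤ √n * G1 G * G2 G :=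
  (pow_le_pow_left₀ (G1_nonneg G) (G1_le_G2 G) 2).trans (G2_sq_le G)

end Means

/-! ### Tuples of permutations -/

section Tuples

/-- The index processed at time `t` when the permutations of the successive epochs are
`σ 0, …, σ (K - 1)`. Epochs beyond these use the identity. -/
def tupleIndex {n K : ℕ} [NeZero n] (σ : Fin K → Equiv.Perm (Fin n)) (t : ℕ) : Fin n :=
  (if h : (t - 1) / n < K then σ ⟨(t - 1) / n, h⟩ else 1) (Fin.ofNat n (t - 1))

variable {n K : ℕ}

theorem tupleIndex_epoch [NeZero n] (σ : Fin K → Equiv.Perm (Fin n)) (k : Fin K) (q : Fin n) :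
    tupleIndex σ (k * n + q + 1) = σ k q := by
  have hn := Nat.pos_of_neZero n
  have e : (k * n + q + 1 - 1) / n = k := by
    rw [Nat.add_sub_cancel, mul_comm, Nat.mul_add_div hn, Nat.div_eq_of_lt q.2, add_zero]
  have e' : Fin.ofNat n (k * n + q + 1 - 1) = q := by
    ext
    simp [Nat.mod_eq_of_lt q.2]
  rw [tupleIndex, e', dif_pos (by rw [e]; exact k.2)]
  congr 2
  exact Fin.ext e

theorem exists_epoch [NeZero n] {T t : ℕ} (hT : T ≤ K * n) (h1 : 1 ≤ t) (ht : t ≤ T) :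
    ∃ (k : Fin K) (r : Fin n), t = k * n + r + 1 := by
  have hn := Nat.pos_of_neZero n
  refine ⟨⟨(t - 1) / n, (Nat.div_lt_iff_lt_mul hn).2 (by omega)⟩,
    ⟨(t - 1) % n, Nat.mod_lt _ hn⟩, ?_⟩
  have := Nat.div_add_mod' (t - 1) n
  simp only
  omega

/-- Exchange the roles of the positions `q` and `r` in epoch `k`. -/
def swapTuple (k : Fin K) (q r : Fin n) : Fin K → Equiv.Perm (Fin n) :=
  Pi.mulSingle k (Equiv.swap q r)

theorem mul_swapTuple_apply (σ : Fin K → Equiv.Perm (Fin n)) (k : Fin K) (q r p : Fin n) :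
    (σ * swapTuple k q r) k p = σ k (Equiv.swap q r p) := by
  simp [swapTuple]

theorem tupleIndex_mul_swapTuple [NeZero n] (σ : Fin K → Equiv.Perm (Fin n)) (k : Fin K)
    (q r : Fin n) {t : ℕ} (h1 : 1 ≤ t) (hq : t ≠ k * n + q + 1) (hr : t ≠ k * n + r + 1) :
    tupleIndex (σ * swapTuple k q r) t = tupleIndex σ t := by
  unfold tupleIndex
  split_ifs with h
  · by_cases hk : (⟨(t - 1) / n, h⟩ : Fin K) = k
    · have hmod := Nat.div_add_mod' (t - 1) n
      have hk' : (t - 1) / n = k := congrArg Fin.val hk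
      rw [hk'] at hmod
      rw [hk, mul_swapTuple_apply, Equiv.swap_apply_of_ne_of_ne]
      · rintro rfl
        apply hq
        simp
        omega
      · rintro rfl
        apply hr
        simp
        omega
    · simp [swapTuple, Pi.mulSingle_eq_of_ne hk]
  · rfl

theorem expect_mul_right (ρ : Fin K → Equiv.Perm (Fin n))
    (h : (Fin K → Equiv.Perm (Fin n)) → ℝ) :
    Finset.univ.expect (fun σ => h (σ * ρ)) = Finset.univ.expect h :=
  Fintype.expect_equiv (Equiv.mulRight ρ) _ _ fun _ => rfl

/-- The index at a given position of a given epoch is uniformly distributed. -/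
theorem expect_apply [NeZero n] (k : Fin K) (p : Fin n) (u : Fin n → ℝ) :
    Finset.univ.expect (fun σ : Fin K → Equiv.Perm (Fin n) => u (σ k p))
      = 1 / (n : ℝ) * ∑ i, u i := by
  have hn : (n : ℝ) ≠ 0 := by exact_mod_cast NeZero.ne n
  have h : ∀ q, Finset.univ.expect (fun σ : Fin K → Equiv.Perm (Fin n) => u (σ k q))
      = Finset.univ.expect (fun σ : Fin K → Equiv.Perm (Fin n) => u (σ k p)) := by
    intro q
    rw [← expect_mul_right (swapTuple k p q)]
    simp only [mul_swapTuple_apply, Equiv.swap_apply_right]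
  have hs : ∑ q : Fin n, Finset.univ.expect (fun σ : Fin K → Equiv.Perm (Fin n) => u (σ k q))
      = ∑ i, u i := by
    rw [← Finset.expect_sum_comm]
    simp_rw [fun σ : Fin K → Equiv.Perm (Fin n) => Equiv.sum_comp (σ k) u]
    exact Finset.expect_const Finset.univ_nonempty _
  rw [Finset.sum_congr rfl fun q _ => h q] at hs
  simp only [Finset.sum_const, Finset.card_univ, Fintype.card_fin, nsmul_eq_mul] at hs
  rw [← hs]
  field_simp

/-- Sampling without replacement costs at most a factor `2 ≥ n / (n - 1)` compared with
independent samples. -/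
theorem expect_mul_le [NeZero n] (k : Fin K) {p r : Fin n} (hpr : p ≠ r) (u w : Fin n → ℝ)
    (hu : ∀ i, 0 ≤ u i) (hw : ∀ i, 0 ≤ w i) :
    Finset.univ.expect (fun σ : Fin K → Equiv.Perm (Fin n) => u (σ k r) * w (σ k p))
      ≤ 2 * (1 / (n : ℝ) * ∑ i, u i) * (1 / (n : ℝ) * ∑ i, w i) := by
  set A := Finset.univ.expect (fun σ : Fin K → Equiv.Perm (Fin n) => u (σ k r) * w (σ k p))
    with hA
  have h : ∀ q ∈ Finset.univ.erase r,
      Finset.univ.expect (fun σ : Fin K → Equiv.Perm (Fin n) => u (σ k r) * w (σ k q)) = A := by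
    intro q hq
    have hqr : q ≠ r := Finset.ne_of_mem_erase hq
    rw [← expect_mul_right (swapTuple k p q)]
    simp only [mul_swapTuple_apply, Equiv.swap_apply_of_ne_of_ne hpr.symm hqr.symm,
      Equiv.swap_apply_right, hA]
  have hs : ∑ q ∈ Finset.univ.erase r,
      Finset.univ.expect (fun σ : Fin K → Equiv.Perm (Fin n) => u (σ k r) * w (σ k q))
      ≤ (1 / (n : ℝ) * ∑ i, u i) * ∑ i, w i := by
    rw [← Finset.expect_sum_comm, ← expect_apply k r, Finset.expect_mul]
    refine Finset.expect_le_expect fun σ _ => ?_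
    rw [← Finset.mul_sum]
    refine mul_le_mul_of_nonneg_left ?_ (hu _)
    rw [← Equiv.sum_comp (σ k) w]
    exact Finset.sum_le_sum_of_subset_of_nonneg (Finset.subset_univ _) fun i _ _ => hw _
  rw [Finset.sum_congr rfl h, Finset.sum_const, Finset.card_erase_of_mem (Finset.mem_univ _),
    Finset.card_univ, Fintype.card_fin, nsmul_eq_mul] at hs
  have hn2 : 2 ≤ n := by
    have h1 := p.2
    have h2 := r.2
    have h3 : (p : ℕ) ≠ r := fun h => hpr (Fin.ext h)
    omega
  have hn : (2 : ℝ) ≤ n := by exact_mod_cast hn2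
  rw [Nat.cast_sub (by omega), Nat.cast_one] at hs
  have hA0 : 0 ≤ A := Finset.expect_nonneg fun σ _ => mul_nonneg (hu _) (hw _)
  have h2 : n / 2 * A ≤ (1 / (n : ℝ) * ∑ i, u i) * ∑ i, w i := by nlinarith
  calc A = 2 / n * (n / 2 * A) := by field_simp
    _ ≤ 2 / n * ((1 / (n : ℝ) * ∑ i, u i) * ∑ i, w i) := by gcongr
    _ = _ := by ring

end Tuples

/-! ### Exchangeability within an epoch -/

/-- The real value of the objective `f + ψ` on `dom ψ`. -/
noncomputable def realObjective {d n : ℕ} (f : Fin n → E d → ℝ) (ψ : E d → EReal) (y : E d) : ℝ :=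
  avgFun f y + (ψ y).toReal

namespace IsProblem

variable {d n K T : ℕ} [NeZero n] {f : Fin n → E d → ℝ} {ψ : E d → EReal} {G : Fin n → ℝ≥0}
  {g : Fin n → E d → E d} {η : ℕ → ℝ} {x₁ : E d} {X : (Fin K → Equiv.Perm (Fin n)) → ℕ → E d}

theorem run_swap_eq (hP : IsProblem f ψ G g) (hη : IsStepsize η) (hx₁ : x₁ ∈ dom ψ)
    (hX : ∀ σ, IsProxRun ψ g T η (tupleIndex σ) x₁ (X σ)) (σ : Fin K → Equiv.Perm (Fin n))
    (k : Fin K) (q r : Fin n) {s : ℕ} (h1 : 1 ≤ s) (hT : s ≤ T + 1) (hq : s ≤ k * n + q + 1)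
    (hr : s ≤ k * n + r + 1) : X (σ * swapTuple k q r) s = X σ s :=
  hP.run_eq hη.pos hx₁ (hX _) (hX σ) h1 hT fun _ ht1 ht2 =>
    tupleIndex_mul_swapTuple σ k q r ht1 (by omega) (by omega)

theorem norm_run_swap_sub_le (hP : IsProblem f ψ G g) (hη : IsStepsize η) (hx₁ : x₁ ∈ dom ψ)
    (hX : ∀ σ, IsProxRun ψ g T η (tupleIndex σ) x₁ (X σ)) (σ : Fin K → Equiv.Perm (Fin n))
    (k : Fin K) {q r : Fin n} (hqr : q < r) {s : ℕ} (h1 : 1 ≤ s) (hT : s ≤ T + 1)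
    (hr : s ≤ k * n + r + 1) {c : ℝ} (hc : 0 < c) :
    ‖X (σ * swapTuple k q r) s - X σ s‖ ≤ η (k * n + q + 1) * (G (σ k r) + G (σ k q))
      + (c + (∑ p ∈ Finset.Ioo q r, 4 * η (k * n + p + 1) ^ 2 * (G (σ k p) : ℝ) ^ 2) / c) / 2 := by
  have hqr' : (q : ℕ) < r := hqr
  set Y := ∑ p ∈ Finset.Ioo q r, 4 * η (k * n + p + 1) ^ 2 * (G (σ k p) : ℝ) ^ 2 with hY
  have hY0 : 0 ≤ Y := Finset.sum_nonneg fun p _ => by positivity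
  have hηq := hη.pos (k * n + q + 1) (by omega)
  rcases le_or_gt s (k * n + q + 1) with hs | hs
  · rw [hP.run_swap_eq hη hx₁ hX σ k q r h1 hT hs hr, sub_self, norm_zero]
    positivity
  have h := hP.norm_sq_run_sub_le hη.pos hx₁ (hX σ) (hX (σ * swapTuple k q r))
    (a := k * n + q + 1) (by omega) hs hT fun t ht1 ht2 hta =>
      (tupleIndex_mul_swapTuple σ k q r ht1 hta (by omega)).symm
  rw [tupleIndex_epoch, tupleIndex_epoch, mul_swapTuple_apply, Equiv.swap_apply_left,
    norm_sub_rev] at h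
  have hsum : ∑ t ∈ Finset.Ioo (k * n + q + 1) s, 4 * η t ^ 2 * (G (tupleIndex σ t) : ℝ) ^ 2
      ≤ Y := by
    have e : Y = ∑ t ∈ Finset.Ioo (k * n + q + 1) (k * n + r + 1),
        4 * η t ^ 2 * (G (tupleIndex σ t) : ℝ) ^ 2 := by
      refine Finset.sum_nbij (fun p : Fin n => (k : ℕ) * n + p + 1) ?_ ?_ ?_ ?_
      · intro p hp
        have hp1 : (q : ℕ) < p := (Finset.mem_Ioo.1 hp).1
        have hp2 : (p : ℕ) < r := (Finset.mem_Ioo.1 hp).2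
        exact Finset.mem_Ioo.2 ⟨by omega, by omega⟩
      · intro p _ p' _ h
        exact Fin.ext (by simpa using h)
      · intro t ht
        have ht' := Finset.mem_Ioo.1 (Finset.mem_coe.1 ht)
        refine ⟨⟨t - 1 - k * n, by omega⟩, Finset.mem_coe.2 (Finset.mem_Ioo.2
          ⟨Fin.lt_def.2 ?_, Fin.lt_def.2 ?_⟩), ?_⟩ <;> simp only <;> omega
      · intro p _
        rw [tupleIndex_epoch]
    rw [e]
    exact Finset.sum_le_sum_of_subset_of_nonneg (Finset.Ioo_subset_Ioo_right hr)
      fun t _ _ => by positivity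
  have hAM : Y ≤ ((c + Y / c) / 2) ^ 2 := by
    have : c * (Y / c) = Y := by field_simp
    nlinarith [sq_nonneg (c - Y / c)]
  rw [add_comm (G (σ k r) : ℝ)]
  refine le_of_sq_le_sq ?_ (by positivity)
  have : 0 ≤ η (k * n + q + 1) * (G (σ k q) + G (σ k r)) * ((c + Y / c) / 2) := by positivity
  nlinarith

/-- Before time `t`, the component processed at time `t` behaves in expectation like a fresh
uniform sample, up to the instability of the iterates under one exchange inside the epoch. -/
theorem abs_expect_avgFun_sub_le (hP : IsProblem f ψ G g) (hη : IsStepsize η) (hx₁ : x₁ ∈ dom ψ)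
    (hX : ∀ σ, IsProxRun ψ g T η (tupleIndex σ) x₁ (X σ)) (hK : T ≤ K * n) {s t : ℕ}
    (h1 : 1 ≤ s) (hst : s ≤ t) (ht : t ≤ T) :
    |Finset.univ.expect (fun σ => avgFun f (X σ s) - f (tupleIndex σ t) (X σ s))|
      ≤ 9 * (√n * G1 G * G2 G) * η t := by
  obtain ⟨k, r, rfl⟩ := exists_epoch hK (h1.trans hst) ht
  have hn : (0 : ℝ) < n := by exact_mod_cast Nat.pos_of_neZero n
  have hG1 := G1_pos G hP.pos
  have hG2 : 0 < G2 G := hG1.trans_le (G1_le_G2 G)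
  set h := η (k * n + r + 1) with hh
  have hh0 : 0 < h := hη.pos _ (by omega)
  -- the value of `c` that balances the two halves of the estimate `√Y ≤ (c + Y / c) / 2`
  set c := √n * h * G2 G with hcdef
  have hc : 0 < c := by positivity
  have hdom : ∀ σ, X σ s ∈ dom ψ := fun σ => mem_dom_of_run hx₁ (hX σ) h1 (by omega)
  have hswap : Finset.univ.expect (fun σ => avgFun f (X σ s) - f (σ k r) (X σ s))
      = 1 / (n : ℝ) * ∑ q, Finset.univ.expect (fun σ =>
          f (σ k r) (X (σ * swapTuple k q r) s) - f (σ k r) (X σ s)) := by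
    have e1 : ∀ q, Finset.univ.expect (fun σ => f (σ k r) (X (σ * swapTuple k q r) s))
        = Finset.univ.expect (fun σ => f (σ k q) (X σ s)) := by
      intro q
      rw [← expect_mul_right (swapTuple k q r) (fun σ => f (σ k q) (X σ s))]
      simp only [mul_swapTuple_apply, Equiv.swap_apply_left]
    simp only [Finset.expect_sub_distrib, e1, Finset.sum_sub_distrib]
    rw [← Finset.expect_sum_comm, mul_sub]
    congr 1
    · rw [Finset.mul_expect]
      refine Finset.expect_congr rfl fun σ _ => ?_
      rw [avgFun, Equiv.sum_comp (σ k) (fun i => f i (X σ s))]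
    · simp only [Finset.sum_const, Finset.card_univ, Fintype.card_fin, nsmul_eq_mul]
      field_simp
  have hfar : ∀ q, ¬ q < r → Finset.univ.expect (fun σ =>
      f (σ k r) (X (σ * swapTuple k q r) s) - f (σ k r) (X σ s)) = 0 := by
    intro q hq
    have hq' : (r : ℕ) ≤ q := not_lt.1 hq
    simp only [hP.run_swap_eq hη hx₁ hX _ k q r h1 (by omega) (by omega) hst, sub_self,
      Finset.expect_const_zero]
  have hnear : ∀ q, q < r → |Finset.univ.expect (fun σ =>
      f (σ k r) (X (σ * swapTuple k q r) s) - f (σ k r) (X σ s))|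
      ≤ 2 * G2 G ^ 2 * η (k * n + q + 1) + c * G1 G / 2
        + 4 * G1 G * G2 G ^ 2 / c * ∑ p ∈ Finset.Ioo q r, η (k * n + p + 1) ^ 2 := by
    intro q hq
    have hηq : 0 < η (k * n + q + 1) := hη.pos _ (by omega)
    have eG1 : Finset.univ.expect (fun σ : Fin K → Equiv.Perm (Fin n) => (G (σ k r) : ℝ)) = G1 G :=
      expect_apply k r fun i => (G i : ℝ)
    have eG2 : ∀ p, Finset.univ.expect (fun σ : Fin K → Equiv.Perm (Fin n) =>
        (G (σ k p) : ℝ) ^ 2) = G2 G ^ 2 := fun p => by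
      rw [G2_sq]; exact expect_apply k p fun i => (G i : ℝ) ^ 2
    have eG3 : ∀ p ∈ Finset.Ioo q r, Finset.univ.expect (fun σ : Fin K → Equiv.Perm (Fin n) =>
        (G (σ k r) : ℝ) * (G (σ k p) : ℝ) ^ 2) ≤ 2 * G1 G * G2 G ^ 2 := fun p hp => by
      rw [G2_sq]
      exact expect_mul_le k (Finset.mem_Ioo.1 hp).2.ne (fun i => (G i : ℝ))
        (fun i => (G i : ℝ) ^ 2) (fun i => (G i).2) (fun i => by positivity)
    calc |Finset.univ.expect (fun σ =>
            f (σ k r) (X (σ * swapTuple k q r) s) - f (σ k r) (X σ s))|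
        ≤ Finset.univ.expect (fun σ =>
            |f (σ k r) (X (σ * swapTuple k q r) s) - f (σ k r) (X σ s)|) :=
          Finset.abs_expect_le _ _
      _ ≤ Finset.univ.expect (fun σ : Fin K → Equiv.Perm (Fin n) =>
            3 / 2 * η (k * n + q + 1) * (G (σ k r) : ℝ) ^ 2
            + 1 / 2 * η (k * n + q + 1) * (G (σ k q) : ℝ) ^ 2 + c / 2 * (G (σ k r) : ℝ)
            + ∑ p ∈ Finset.Ioo q r, 2 / c * η (k * n + p + 1) ^ 2
                * ((G (σ k r) : ℝ) * (G (σ k p) : ℝ) ^ 2)) := by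
          refine Finset.expect_le_expect fun σ _ => ?_
          refine (hP.abs_sub_le _ (hdom _) (hdom _)).trans ?_
          refine (mul_le_mul_of_nonneg_left (hP.norm_run_swap_sub_le hη hx₁ hX σ k hq h1
            (by omega) hst hc) (G (σ k r)).coe_nonneg).trans ?_
          have e : ∑ p ∈ Finset.Ioo q r, 2 / c * η (k * n + p + 1) ^ 2
              * ((G (σ k r) : ℝ) * (G (σ k p) : ℝ) ^ 2)
              = (G (σ k r) : ℝ) * ((∑ p ∈ Finset.Ioo q r,
                4 * η (k * n + p + 1) ^ 2 * (G (σ k p) : ℝ) ^ 2) / c / 2) := by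
            rw [Finset.sum_div, Finset.sum_div, Finset.mul_sum]
            refine Finset.sum_congr rfl fun p _ => ?_
            ring
          rw [e]
          nlinarith [mul_nonneg hηq.le (sq_nonneg ((G (σ k r) : ℝ) - G (σ k q)))]
      _ ≤ _ := by
          simp only [Finset.expect_add_distrib, ← Finset.mul_expect, Finset.expect_sum_comm]
          rw [eG1, eG2, eG2, Finset.mul_sum]
          have hs : ∑ p ∈ Finset.Ioo q r, 2 / c * η (k * n + p + 1) ^ 2
              * Finset.univ.expect (fun σ : Fin K → Equiv.Perm (Fin n) =>
                (G (σ k r) : ℝ) * (G (σ k p) : ℝ) ^ 2)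
              ≤ ∑ p ∈ Finset.Ioo q r, 4 * G1 G * G2 G ^ 2 / c * η (k * n + p + 1) ^ 2 := by
            refine Finset.sum_le_sum fun p hp => ?_
            calc _ ≤ 2 / c * η (k * n + p + 1) ^ 2 * (2 * G1 G * G2 G ^ 2) :=
                  mul_le_mul_of_nonneg_left (eG3 p hp) (by positivity)
              _ = _ := by ring
          linarith
  have hsum1 := hη.sum_epoch_le (k * n) r
  have hsum2 := hη.sum_sum_sq_epoch_le (k * n) r
  rw [← hh] at hsum1 hsum2
  have hcard : ((Finset.Iio r).card : ℝ) ≤ n := by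
    rw [Fin.card_Iio]; exact_mod_cast r.2.le
  simp only [tupleIndex_epoch]
  rw [hswap, abs_mul, abs_of_pos (by positivity)]
  calc 1 / (n : ℝ) * |∑ q, Finset.univ.expect (fun σ =>
          f (σ k r) (X (σ * swapTuple k q r) s) - f (σ k r) (X σ s))|
      = 1 / (n : ℝ) * |∑ q ∈ Finset.Iio r, Finset.univ.expect (fun σ =>
          f (σ k r) (X (σ * swapTuple k q r) s) - f (σ k r) (X σ s))| := by
        congr 2
        refine (Finset.sum_subset (Finset.subset_univ _) fun q _ hq => hfar q ?_).symm
        simpa using hq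
    _ ≤ 1 / (n : ℝ) * ∑ q ∈ Finset.Iio r, (2 * G2 G ^ 2 * η (k * n + q + 1) + c * G1 G / 2
        + 4 * G1 G * G2 G ^ 2 / c * ∑ p ∈ Finset.Ioo q r, η (k * n + p + 1) ^ 2) := by
        gcongr
        exact (Finset.abs_sum_le_sum_abs _ _).trans
          (Finset.sum_le_sum fun q hq => hnear q (Finset.mem_Iio.1 hq))
    _ ≤ 1 / (n : ℝ) * (2 * G2 G ^ 2 * (2 * n * h) + n * (c * G1 G / 2)
        + 4 * G1 G * G2 G ^ 2 / c * ((n : ℝ) ^ 2 * h ^ 2)) := by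
        rw [Finset.sum_add_distrib, Finset.sum_add_distrib, ← Finset.mul_sum, ← Finset.mul_sum,
          Finset.sum_const, nsmul_eq_mul]
        gcongr
    _ = 4 * G2 G ^ 2 * h + 9 / 2 * (√n * G1 G * G2 G) * h := by
        have hsq : (n : ℝ) = √n ^ 2 := (Real.sq_sqrt hn.le).symm
        have hs0 : √(n : ℝ) ≠ 0 := by positivity
        have e : 4 * G1 G * G2 G ^ 2 / c * ((n : ℝ) ^ 2 * h ^ 2)
            = n * (4 * (√n * G1 G * G2 G) * h) := by
          rw [hcdef]
          field_simp
          linear_combination hsq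
        rw [e, hcdef]
        have hn0 := hn.ne'
        clear_value h
        rw [mul_add, mul_add, ← mul_assoc, ← mul_assoc]
        generalize √(n : ℝ) = w
        field_simp
        ring
    _ ≤ _ := by
        have hM := mul_le_mul_of_nonneg_right (G2_sq_le G) hh0.le
        have : 0 ≤ √n * G1 G * G2 G * h := by positivity
        linarith

/-- One step in expectation, compared with a possibly random point `Z` at which the sampled
component is nearly unbiased. -/
theorem expect_step_le (hP : IsProblem f ψ G g) (hη : IsStepsize η) (hx₁ : x₁ ∈ dom ψ)
    (hX : ∀ σ, IsProxRun ψ g T η (tupleIndex σ) x₁ (X σ)) (hK : T ≤ K * n) {t : ℕ}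
    (h1 : 1 ≤ t) (ht : t ≤ T) (Z : (Fin K → Equiv.Perm (Fin n)) → E d)
    (hZ : ∀ σ, Z σ ∈ dom ψ)
    (hZt : |Finset.univ.expect (fun σ => avgFun f (Z σ) - f (tupleIndex σ t) (Z σ))|
      ≤ 9 * (√n * G1 G * G2 G) * η t) :
    η t * Finset.univ.expect (fun σ => realObjective f ψ (X σ (t + 1)) - realObjective f ψ (Z σ))
      ≤ Finset.univ.expect (fun σ => ‖Z σ - X σ t‖ ^ 2 / 2)
        - Finset.univ.expect (fun σ => ‖Z σ - X σ (t + 1)‖ ^ 2 / 2)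
        + 20 * (√n * G1 G * G2 G) * η t ^ 2 := by
  have hηt := hη.pos t h1
  have hXt := hP.abs_expect_avgFun_sub_le hη hx₁ hX hK h1 le_rfl ht
  have hG2 : Finset.univ.expect (fun σ : Fin K → Equiv.Perm (Fin n) =>
      (G (tupleIndex σ t) : ℝ) ^ 2) = G2 G ^ 2 := by
    obtain ⟨k, r, rfl⟩ := exists_epoch hK h1 ht
    simp only [tupleIndex_epoch]
    rw [G2_sq]; exact expect_apply k r fun i => (G i : ℝ) ^ 2
  have hpt := Finset.expect_le_expect (s := Finset.univ) fun σ _ =>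
    mul_le_mul_of_nonneg_left (hP.step_le (tupleIndex σ t) hηt
      (mem_dom_of_run hx₁ (hX σ) h1 (by omega)) (hZ σ)
      ((hX σ).step t (Finset.mem_Icc.2 ⟨h1, ht⟩))) hηt.le
  have e1 : ∀ σ, η t * ((avgFun f (X σ (t + 1)) + (ψ (X σ (t + 1))).toReal)
      - (avgFun f (X σ t) - f (tupleIndex σ t) (X σ t))
      - (f (tupleIndex σ t) (Z σ) + (ψ (Z σ)).toReal))
      = η t * (realObjective f ψ (X σ (t + 1)) - realObjective f ψ (Z σ))
        - η t * (avgFun f (X σ t) - f (tupleIndex σ t) (X σ t))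
        + η t * (avgFun f (Z σ) - f (tupleIndex σ t) (Z σ)) := by
    intro σ; simp only [realObjective]; ring
  have e2 : ∀ σ, η t * ((‖Z σ - X σ t‖ ^ 2 - ‖Z σ - X σ (t + 1)‖ ^ 2) / (2 * η t)
      + η t * ((G (tupleIndex σ t) : ℝ) ^ 2 + G1 G ^ 2))
      = ‖Z σ - X σ t‖ ^ 2 / 2 - ‖Z σ - X σ (t + 1)‖ ^ 2 / 2
        + η t ^ 2 * (G (tupleIndex σ t) : ℝ) ^ 2 + η t ^ 2 * G1 G ^ 2 := by
    intro σ; field_simp; ring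
  simp only [e1, e2] at hpt
  rw [Finset.expect_add_distrib, Finset.expect_sub_distrib, Finset.expect_add_distrib,
    Finset.expect_add_distrib, Finset.expect_sub_distrib, ← Finset.mul_expect,
    ← Finset.mul_expect, ← Finset.mul_expect, ← Finset.mul_expect, hG2,
    Finset.expect_const Finset.univ_nonempty] at hpt
  have h2 := mul_le_mul_of_nonneg_left (abs_le.1 hXt).2 hηt.le
  have h3 := mul_le_mul_of_nonneg_left (abs_le.1 hZt).1 hηt.le
  have h4 := mul_le_mul_of_nonneg_left (G2_sq_le G) (sq_nonneg (η t))
  have h5 := mul_le_mul_of_nonneg_left (G1_sq_le G) (sq_nonneg (η t))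
  nlinarith

end IsProblem

/-! ### From sums of gaps to suffix averages -/

/-- If the weighted sums of the gaps `b` over the whole horizon are controlled, as well as those
of the increments over `b s` from each time `s`, then every weighted suffix average is controlled:
the second bound limits how much the average can grow when its first term is dropped. -/
theorem IsStepsize.suffix_le {η : ℕ → ℝ} (hη : IsStepsize η) {b : ℕ → ℝ} {N : ℕ} {R M : ℝ}
    (hM : 0 ≤ M)
    (h0 : ∑ t ∈ Finset.Icc 1 N, η t * b (t + 1) ≤ R + M * ∑ t ∈ Finset.Icc 1 N, η t ^ 2)
    (hs : ∀ s, 1 ≤ s → s ≤ N → ∑ t ∈ Finset.Icc s N, η t * (b (t + 1) - b s)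
      ≤ M * ∑ t ∈ Finset.Icc s N, η t ^ 2) {m : ℕ} (h1 : 1 ≤ m) (hm : m ≤ N) :
    (∑ t ∈ Finset.Icc m N, η t * b (t + 1)) / ∑ t ∈ Finset.Icc m N, η t
      ≤ R / ∑ t ∈ Finset.Icc 1 N, η t
        + M * ((∑ t ∈ Finset.Icc 1 N, η t ^ 2) / ∑ t ∈ Finset.Icc 1 N, η t
          + ∑ s ∈ Finset.Ico 1 m, η s ^ 2 / ∑ t ∈ Finset.Icc s N, η t) := by
  have hW : ∀ s, 1 ≤ s → s ≤ N → 0 < ∑ t ∈ Finset.Icc s N, η t := fun s h1 h2 =>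
    Finset.sum_pos (fun t ht => hη.pos t (h1.trans (Finset.mem_Icc.1 ht).1))
      (Finset.nonempty_Icc.2 h2)
  induction m, h1 using Nat.le_induction with
  | base =>
    rw [Finset.Ico_self, Finset.sum_empty, add_zero, ← mul_div_assoc, ← add_div]
    exact div_le_div_of_nonneg_right h0 (hW 1 le_rfl hm).le
  | succ s h1 ih =>
    have ih := ih (by omega)
    rw [Finset.sum_Ico_succ_top h1]
    have hins : Finset.Icc s N = insert s (Finset.Icc (s + 1) N) := by
      ext; simp only [Finset.mem_Icc, Finset.mem_insert]; omega
    have hnot : s ∉ Finset.Icc (s + 1) N := by simp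
    have hW1 := hW s h1 (by omega)
    have hW2 := hW (s + 1) (by omega) hm
    set W := ∑ t ∈ Finset.Icc (s + 1) N, η t with hWdef
    set S := ∑ t ∈ Finset.Icc (s + 1) N, η t * b (t + 1) with hS
    have eW : ∑ t ∈ Finset.Icc s N, η t = η s + W := by rw [hins, Finset.sum_insert hnot]
    have eS : ∑ t ∈ Finset.Icc s N, η t * b (t + 1) = η s * b (s + 1) + S := by
      rw [hins, Finset.sum_insert hnot]
    -- dropping the first term: compare the rest of the average with that term
    have hb : S - W * b (s + 1) ≤ M * (η s * W) := by
      have h := hs (s + 1) (by omega) hm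
      simp only [mul_sub, Finset.sum_sub_distrib, ← Finset.sum_mul] at h
      refine h.trans (mul_le_mul_of_nonneg_left ?_ hM)
      rw [hWdef, Finset.mul_sum]
      refine Finset.sum_le_sum fun t ht => ?_
      have ht' := Finset.mem_Icc.1 ht
      rw [sq]
      exact mul_le_mul_of_nonneg_right (hη.anti s t h1 (by omega)) (hη.pos t (by omega)).le
    rw [eW] at hW1
    have key : S / W ≤ (η s * b (s + 1) + S) / (η s + W) + M * (η s ^ 2 / (η s + W)) := by
      rw [← mul_div_assoc, ← add_div, div_le_div_iff₀ hW2 hW1]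
      have := mul_le_mul_of_nonneg_left hb (hη.pos s h1).le
      nlinarith
    rw [eS] at ih
    rw [eW] at ih ⊢
    linarith

theorem sum_Icc_inv_le (N : ℕ) : ∑ s ∈ Finset.Icc 1 N, 1 / (s : ℝ) ≤ 1 + Real.log N := by
  have h := harmonic_le_one_add_log N
  rw [harmonic_eq_sum_Icc] at h
  push_cast at h
  simpa using h

theorem sum_Icc_inv_reflect_le (N : ℕ) :
    ∑ s ∈ Finset.Icc 1 N, 1 / ((N : ℝ) - s + 1) ≤ 1 + Real.log N := by
  refine le_trans (le_of_eq ?_) (sum_Icc_inv_le N)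
  refine Finset.sum_nbij' (fun s => N + 1 - s) (fun s => N + 1 - s) ?_ ?_ ?_ ?_ ?_
  · intro s hs; simp only [Finset.mem_Icc] at hs ⊢; omega
  · intro s hs; simp only [Finset.mem_Icc] at hs ⊢; omega
  · intro s hs; simp only [Finset.mem_Icc] at hs; omega
  · intro s hs; simp only [Finset.mem_Icc] at hs; omega
  · intro s hs
    simp only [Finset.mem_Icc] at hs
    rw [Nat.cast_sub (by omega)]
    push_cast
    ring

theorem isStepsize_const {η : ℝ} (hη : 0 < η) : IsStepsize fun _ => η where
  pos _ _ := hη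
  anti _ _ _ _ := le_rfl
  mono s t _ hst := by
    have : (s : ℝ) ≤ t := by exact_mod_cast hst
    gcongr

theorem isStepsize_div_sqrt {η : ℝ} (hη : 0 < η) : IsStepsize fun t => η / √(t : ℝ) where
  pos t ht := div_pos hη (Real.sqrt_pos.2 (by exact_mod_cast ht))
  anti s t hs hst := by
    have : 0 < √(s : ℝ) := Real.sqrt_pos.2 (by exact_mod_cast hs)
    gcongr
  mono s t hs hst := by
    have h1 : (s : ℝ) ≠ 0 := by positivity
    have h2 : (t : ℝ) ≠ 0 := by have : 0 < t := by omega
                                positivity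
    rw [div_pow, div_pow, Real.sq_sqrt (by positivity), Real.sq_sqrt (by positivity)]
    field_simp
    exact le_rfl

/-- The weights in `IsStepsize.suffix_le` for a constant stepsize. -/
theorem suffix_const_le {η : ℝ} (hη : 0 < η) {N m : ℕ} (h1 : 1 ≤ m) (hm : m ≤ N) :
    (∑ _t ∈ Finset.Icc 1 N, η ^ 2) / ∑ _t ∈ Finset.Icc 1 N, η
      + ∑ s ∈ Finset.Ico 1 m, η ^ 2 / ∑ _t ∈ Finset.Icc s N, η ≤ 2 * η * (1 + Real.log N) := by
  have hN : (0 : ℝ) < N := by exact_mod_cast (by omega : 0 < N)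
  have hlog : 0 ≤ Real.log N := Real.log_natCast_nonneg N
  have e1 : (∑ _t ∈ Finset.Icc 1 N, η ^ 2) / ∑ _t ∈ Finset.Icc 1 N, η = η := by
    simp only [Finset.sum_const, Nat.card_Icc, Nat.add_sub_cancel, nsmul_eq_mul]
    field_simp
  have e2 : ∑ s ∈ Finset.Ico 1 m, η ^ 2 / ∑ _t ∈ Finset.Icc s N, η
      ≤ ∑ s ∈ Finset.Icc 1 N, η * (1 / ((N : ℝ) - s + 1)) := by
    have hsub : Finset.Ico 1 m ⊆ Finset.Icc 1 N := fun s hs => by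
      simp only [Finset.mem_Ico, Finset.mem_Icc] at hs ⊢; omega
    have e : ∀ s ∈ Finset.Ico 1 m, η ^ 2 / ∑ _t ∈ Finset.Icc s N, η
        = η * (1 / ((N : ℝ) - s + 1)) := by
      intro s hs
      have hs' := Finset.mem_Ico.1 hs
      have hsN : (s : ℝ) ≤ N := by exact_mod_cast (by omega : s ≤ N)
      have hpos : (0 : ℝ) < (N : ℝ) - s + 1 := by linarith
      have hc : ((N + 1 - s : ℕ) : ℝ) = (N : ℝ) - s + 1 := by
        rw [Nat.cast_sub (by omega)]; push_cast; ring
      rw [Finset.sum_const, Nat.card_Icc, nsmul_eq_mul, hc]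
      field_simp
    rw [Finset.sum_congr rfl e]
    refine Finset.sum_le_sum_of_subset_of_nonneg hsub fun s hs _ => ?_
    have hsN : (s : ℝ) ≤ N := by exact_mod_cast (Finset.mem_Icc.1 hs).2
    have hpos : (0 : ℝ) < (N : ℝ) - s + 1 := by linarith
    positivity
  rw [← Finset.mul_sum] at e2
  have h3 := mul_le_mul_of_nonneg_left (sum_Icc_inv_reflect_le N) hη.le
  rw [e1]
  nlinarith

theorem mul_div_sqrt_le_sum {η : ℝ} (hη : 0 < η) {N s : ℕ} (h1 : 1 ≤ s) (hs : s ≤ N) :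
    ((N : ℝ) - s + 1) * (η / √(N : ℝ)) ≤ ∑ t ∈ Finset.Icc s N, η / √(t : ℝ) := by
  have hc : ((N + 1 - s : ℕ) : ℝ) = (N : ℝ) - s + 1 := by
    rw [Nat.cast_sub (by omega)]; push_cast; ring
  rw [← hc, ← nsmul_eq_mul, ← Nat.card_Icc]
  refine Finset.card_nsmul_le_sum _ _ _ fun t ht => ?_
  have ht' := Finset.mem_Icc.1 ht
  exact (isStepsize_div_sqrt hη).anti t N (by omega) ht'.2

/-- The weights in `IsStepsize.suffix_le` for the last iterate with stepsizes `η / √t`. -/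
theorem suffix_div_sqrt_le {η : ℝ} (hη : 0 < η) {N : ℕ} (hN : 1 ≤ N) :
    (∑ t ∈ Finset.Icc 1 N, (η / √(t : ℝ)) ^ 2) / ∑ t ∈ Finset.Icc 1 N, η / √(t : ℝ)
      + ∑ s ∈ Finset.Ico 1 N, (η / √(s : ℝ)) ^ 2 / ∑ t ∈ Finset.Icc s N, η / √(t : ℝ)
      ≤ 3 * η * (1 + Real.log N) / √(N : ℝ) := by
  have hN0 : (0 : ℝ) < N := by exact_mod_cast hN
  have hsN : 0 < √(N : ℝ) := Real.sqrt_pos.2 hN0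
  have hlog : 0 ≤ Real.log N := Real.log_natCast_nonneg N
  have hsq : √(N : ℝ) * √(N : ℝ) = N := Real.mul_self_sqrt hN0.le
  have e1 : (∑ t ∈ Finset.Icc 1 N, (η / √(t : ℝ)) ^ 2) / ∑ t ∈ Finset.Icc 1 N, η / √(t : ℝ)
      ≤ η * (1 + Real.log N) / √(N : ℝ) := by
    have hW := mul_div_sqrt_le_sum hη le_rfl hN
    have hQ : ∑ t ∈ Finset.Icc 1 N, (η / √(t : ℝ)) ^ 2 ≤ η ^ 2 * (1 + Real.log N) := by
      refine le_trans (le_of_eq ?_) (mul_le_mul_of_nonneg_left (sum_Icc_inv_le N) (sq_nonneg η))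
      rw [Finset.mul_sum]
      refine Finset.sum_congr rfl fun t _ => ?_
      rw [div_pow, Real.sq_sqrt (by positivity)]; ring
    have e : ((N : ℝ) - (1 : ℕ) + 1) * (η / √(N : ℝ)) = η * √(N : ℝ) := by
      push_cast
      field_simp
      linarith
    rw [e] at hW
    calc _ ≤ η ^ 2 * (1 + Real.log N) / (η * √(N : ℝ)) := by gcongr
      _ = _ := by field_simp
  have e2 : ∑ s ∈ Finset.Ico 1 N, (η / √(s : ℝ)) ^ 2 / ∑ t ∈ Finset.Icc s N, η / √(t : ℝ)
      ≤ ∑ s ∈ Finset.Icc 1 N, η / √(N : ℝ) * (1 / (s : ℝ) + 1 / ((N : ℝ) - s + 1)) := by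
    have hsub : Finset.Ico 1 N ⊆ Finset.Icc 1 N := Finset.Ico_subset_Icc_self
    refine (Finset.sum_le_sum fun s hs => ?_).trans
      (Finset.sum_le_sum_of_subset_of_nonneg hsub fun s hs _ => ?_)
    · have hs' := Finset.mem_Ico.1 hs
      have hs0 : (0 : ℝ) < s := by exact_mod_cast hs'.1
      have hsN' : (s : ℝ) ≤ N := by exact_mod_cast hs'.2.le
      have hpos : (0 : ℝ) < (N : ℝ) - s + 1 := by linarith
      have hW := mul_div_sqrt_le_sum hη hs'.1 hs'.2.le
      rw [div_pow, Real.sq_sqrt hs0.le]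
      calc η ^ 2 / s / ∑ t ∈ Finset.Icc s N, η / √(t : ℝ)
          ≤ η ^ 2 / s / (((N : ℝ) - s + 1) * (η / √(N : ℝ))) := by gcongr
        _ = η * √(N : ℝ) / (N + 1) * (1 / (s : ℝ) + 1 / ((N : ℝ) - s + 1)) := by
          field_simp; ring
        _ ≤ η / √(N : ℝ) * (1 / (s : ℝ) + 1 / ((N : ℝ) - s + 1)) := by
          gcongr ?_ * _
          rw [div_le_div_iff₀ (by positivity) hsN, mul_assoc, hsq]
          nlinarith
    · have hs' := Finset.mem_Icc.1 hs
      have hsN' : (s : ℝ) ≤ N := by exact_mod_cast hs'.2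
      have hpos : (0 : ℝ) < (N : ℝ) - s + 1 := by linarith
      positivity
  rw [← Finset.mul_sum, Finset.sum_add_distrib] at e2
  have h3 : η / √(N : ℝ) * (∑ s ∈ Finset.Icc 1 N, 1 / (s : ℝ)
      + ∑ s ∈ Finset.Icc 1 N, 1 / ((N : ℝ) - s + 1))
      ≤ η / √(N : ℝ) * ((1 + Real.log N) + (1 + Real.log N)) := by
    gcongr
    · exact sum_Icc_inv_le N
    · exact sum_Icc_inv_reflect_le N
  have e3 : 3 * η * (1 + Real.log N) / √(N : ℝ) = η * (1 + Real.log N) / √(N : ℝ)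
      + η / √(N : ℝ) * ((1 + Real.log N) + (1 + Real.log N)) := by ring
  rw [e3]
  linarith

theorem sum_Icc_inv_sqrt_le {n T : ℕ} (hnT : n ≤ T) :
    ∑ t ∈ Finset.Icc (T - n + 1) T, 1 / √(t : ℝ) ≤ 2 * n / √(T : ℝ) := by
  have h := sum_inv_sqrt_le (T - n) n
  rw [Nat.sub_add_cancel hnT] at h
  refine le_trans (le_of_eq ?_) h
  have e : Finset.Icc (T - n + 1) T = Finset.Ico (T - n + 1) (T + 1) := by ext; simp
  rw [e, Finset.sum_Ico_eq_sum_range]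
  have e' : T + 1 - (T - n + 1) = n := by omega
  rw [e']
  refine Finset.sum_congr rfl fun q _ => ?_
  congr 3
  omega

/-! ### Expected suffix gaps -/

namespace IsProblem

variable {d n K T : ℕ} [NeZero n] {f : Fin n → E d → ℝ} {ψ : E d → EReal} {G : Fin n → ℝ≥0}
  {g : Fin n → E d → E d} {x₁ z : E d} {X : (Fin K → Equiv.Perm (Fin n)) → ℕ → E d}

/-- The weighted suffix averages of the expected gaps, for general stepsizes. -/
theorem expect_suffix_le {η : ℕ → ℝ} (hP : IsProblem f ψ G g) (hη : IsStepsize η)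
    (hx₁ : x₁ ∈ dom ψ) (hX : ∀ σ, IsProxRun ψ g T η (tupleIndex σ) x₁ (X σ)) (hK : T ≤ K * n)
    (hz : z ∈ dom ψ) {m N : ℕ} (h1 : 1 ≤ m) (hm : m ≤ N) (hN : N ≤ T) :
    (∑ t ∈ Finset.Icc m N, η t * Finset.univ.expect (fun σ =>
        realObjective f ψ (X σ (t + 1)) - realObjective f ψ z)) / ∑ t ∈ Finset.Icc m N, η t
      ≤ ‖z - x₁‖ ^ 2 / 2 / ∑ t ∈ Finset.Icc 1 N, η t
        + 20 * (√n * G1 G * G2 G) * ((∑ t ∈ Finset.Icc 1 N, η t ^ 2) / ∑ t ∈ Finset.Icc 1 N, η t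
          + ∑ s ∈ Finset.Ico 1 m, η s ^ 2 / ∑ t ∈ Finset.Icc s N, η t) := by
  have hM : 0 ≤ √n * G1 G * G2 G := by
    have := G1_nonneg G
    have := G2_nonneg G
    positivity
  -- the sum of the one-step inequalities from time `s` on telescopes
  have tele : ∀ (Z : (Fin K → Equiv.Perm (Fin n)) → E d) (s : ℕ), 1 ≤ s → s ≤ N →
      (∀ σ, Z σ ∈ dom ψ) →
      (∀ t, s ≤ t → t ≤ N →
        |Finset.univ.expect (fun σ => avgFun f (Z σ) - f (tupleIndex σ t) (Z σ))|
          ≤ 9 * (√n * G1 G * G2 G) * η t) →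
      ∑ t ∈ Finset.Icc s N, η t * Finset.univ.expect (fun σ =>
          realObjective f ψ (X σ (t + 1)) - realObjective f ψ (Z σ))
        ≤ Finset.univ.expect (fun σ => ‖Z σ - X σ s‖ ^ 2 / 2)
          + 20 * (√n * G1 G * G2 G) * ∑ t ∈ Finset.Icc s N, η t ^ 2 := by
    intro Z s hs hsN hZ hZt
    have h := Finset.sum_le_sum (s := Finset.Icc s N) fun t ht =>
      hP.expect_step_le hη hx₁ hX hK (hs.trans (Finset.mem_Icc.1 ht).1)
        ((Finset.mem_Icc.1 ht).2.trans hN) Z hZ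
        (hZt t (Finset.mem_Icc.1 ht).1 (Finset.mem_Icc.1 ht).2)
    refine h.trans ?_
    rw [Finset.sum_add_distrib, ← Finset.mul_sum]
    gcongr
    have e : Finset.Icc s N = Finset.Ico s (N + 1) := by ext; simp
    rw [e]
    have ht := Finset.sum_Ico_sub (fun t =>
      Finset.univ.expect (fun σ => ‖Z σ - X σ t‖ ^ 2 / 2)) (by omega : s ≤ N + 1)
    have hn : ∑ t ∈ Finset.Ico s (N + 1), (Finset.univ.expect (fun σ => ‖Z σ - X σ t‖ ^ 2 / 2)
        - Finset.univ.expect (fun σ => ‖Z σ - X σ (t + 1)‖ ^ 2 / 2))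
        = -∑ t ∈ Finset.Ico s (N + 1),
          (Finset.univ.expect (fun σ => ‖Z σ - X σ (t + 1)‖ ^ 2 / 2)
          - Finset.univ.expect (fun σ => ‖Z σ - X σ t‖ ^ 2 / 2)) := by
      rw [← Finset.sum_neg_distrib]
      exact Finset.sum_congr rfl fun t _ => (neg_sub _ _).symm
    rw [hn, ht]
    have : 0 ≤ Finset.univ.expect (fun σ => ‖Z σ - X σ (N + 1)‖ ^ 2 / 2) :=
      Finset.expect_nonneg fun σ _ => by positivity
    linarith
  refine hη.suffix_le (b := fun t => Finset.univ.expect (fun σ =>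
    realObjective f ψ (X σ t) - realObjective f ψ z)) (by positivity) ?_ ?_ h1 hm
  · have h := tele (fun _ => z) 1 le_rfl (h1.trans hm) (fun _ => hz) ?_
    · simpa [(hX _).init, Finset.expect_const] using h
    · intro t ht1 htN
      obtain ⟨k, r, rfl⟩ := exists_epoch hK ht1 (htN.trans hN)
      have e := expect_apply (K := K) k r fun i => f i z
      simp only [tupleIndex_epoch, Finset.expect_sub_distrib, e,
        Finset.expect_const Finset.univ_nonempty]
      have := (hη.pos _ ht1).le
      simp only [avgFun, sub_self, abs_zero]
      positivity
  · intro s hs hsN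
    have h := tele (fun σ => X σ s) s hs hsN
      (fun σ => mem_dom_of_run hx₁ (hX σ) hs (by omega))
      fun t hst htN => hP.abs_expect_avgFun_sub_le hη hx₁ hX hK hs hst (htN.trans hN)
    simp only [sub_self, norm_zero] at h
    simp only [← Finset.expect_sub_distrib, sub_sub_sub_cancel_right]
    simpa using h

/-- The uniform suffix average for a constant stepsize. -/
theorem expect_suffix_const_le {η : ℝ} (hP : IsProblem f ψ G g) (hη : 0 < η)
    (hx₁ : x₁ ∈ dom ψ) (hX : ∀ σ, IsProxRun ψ g T (fun _ => η) (tupleIndex σ) x₁ (X σ))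
    (hK : T ≤ K * n) (hz : z ∈ dom ψ) (hnT : n ≤ T) :
    1 / (n : ℝ) * ∑ t ∈ Finset.Icc (T - n + 1) T, Finset.univ.expect (fun σ =>
        realObjective f ψ (X σ (t + 1)) - realObjective f ψ z)
      ≤ 40 * (‖z - x₁‖ ^ 2 / (η * T) + η * √n * G1 G * G2 G * (1 + Real.log T)) := by
  have hn := Nat.pos_of_neZero n
  have hT : (0 : ℝ) < T := by exact_mod_cast (by omega : 0 < T)
  have h := hP.expect_suffix_le (isStepsize_const hη) hx₁ hX hK hz (m := T - n + 1) (N := T)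
    (by omega) (by omega) le_rfl
  have hw := suffix_const_le hη (N := T) (m := T - n + 1) (by omega) (by omega)
  have hM : 0 ≤ √n * G1 G * G2 G := by
    have := G1_nonneg G
    have := G2_nonneg G
    positivity
  have h2 := mul_le_mul_of_nonneg_left hw (by positivity : 0 ≤ 20 * (√n * G1 G * G2 G))
  have ecard : T + 1 - (T - n + 1) = n := by omega
  rw [← Finset.mul_sum, Finset.sum_const (s := Finset.Icc (T - n + 1) T), Nat.card_Icc, ecard,
    nsmul_eq_mul] at h
  have hn' : (0 : ℝ) < n := by exact_mod_cast hn
  have e1 : ∀ S : ℝ, η * S / (n * η) = 1 / (n : ℝ) * S := fun S => by field_simp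
  have e2 : ‖z - x₁‖ ^ 2 / 2 / ∑ _t ∈ Finset.Icc 1 T, η = 1 / 2 * (‖z - x₁‖ ^ 2 / (η * T)) := by
    rw [Finset.sum_const, Nat.card_Icc, Nat.add_sub_cancel, nsmul_eq_mul]
    field_simp
  rw [e1, e2] at h
  have : 0 ≤ ‖z - x₁‖ ^ 2 / (η * T) := by positivity
  linarith

/-- The gap of the last iterate at any time `N ≤ T`, for the stepsizes `η / √t`. -/
theorem expect_last_div_sqrt_le {η : ℝ} (hP : IsProblem f ψ G g) (hη : 0 < η)
    (hx₁ : x₁ ∈ dom ψ) (hX : ∀ σ, IsProxRun ψ g T (fun t => η / √t) (tupleIndex σ) x₁ (X σ))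
    (hK : T ≤ K * n) (hz : z ∈ dom ψ) {N : ℕ} (hN : 1 ≤ N) (hNT : N ≤ T) :
    Finset.univ.expect (fun σ => realObjective f ψ (X σ (N + 1)) - realObjective f ψ z)
      ≤ 60 * (‖z - x₁‖ ^ 2 / η + η * √n * G1 G * G2 G * (1 + Real.log N)) * (1 / √N) := by
  have hN0 : (0 : ℝ) < N := by exact_mod_cast hN
  have hsN : 0 < √(N : ℝ) := Real.sqrt_pos.2 hN0
  have h := hP.expect_suffix_le (isStepsize_div_sqrt hη) hx₁ hX hK hz hN le_rfl hNT
  have hw := suffix_div_sqrt_le hη hN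
  have hM : 0 ≤ √n * G1 G * G2 G := by
    have := G1_nonneg G
    have := G2_nonneg G
    positivity
  have h2 := mul_le_mul_of_nonneg_left hw (by positivity : 0 ≤ 20 * (√n * G1 G * G2 G))
  rw [Finset.Icc_self, Finset.sum_singleton, Finset.sum_singleton,
    mul_div_cancel_left₀ _ (by positivity)] at h
  have h3 : ‖z - x₁‖ ^ 2 / 2 / ∑ t ∈ Finset.Icc 1 N, η / √(t : ℝ)
      ≤ 60 * (‖z - x₁‖ ^ 2 / η) * (1 / √N) := by
    have hW := mul_div_sqrt_le_sum hη le_rfl hN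
    have e : ((N : ℝ) - (1 : ℕ) + 1) * (η / √(N : ℝ)) = η * √(N : ℝ) := by
      have hsq : √(N : ℝ) * √(N : ℝ) = N := Real.mul_self_sqrt hN0.le
      push_cast
      field_simp
      linarith
    rw [e] at hW
    calc _ ≤ ‖z - x₁‖ ^ 2 / 2 / (η * √(N : ℝ)) := by gcongr
      _ = 1 / 2 * (‖z - x₁‖ ^ 2 / η * (1 / √N)) := by field_simp
      _ ≤ _ := by
        have : 0 ≤ ‖z - x₁‖ ^ 2 / η * (1 / √N) := by positivity
        linarith
  have e : 60 * (‖z - x₁‖ ^ 2 / η + η * √n * G1 G * G2 G * (1 + Real.log N)) * (1 / √N)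
      = 60 * (‖z - x₁‖ ^ 2 / η) * (1 / √N)
        + 20 * (√n * G1 G * G2 G) * (3 * η * (1 + Real.log N) / √N) := by ring
  rw [e]
  linarith

/-- The uniform suffix average for the stepsizes `η / √t`. -/
theorem expect_suffix_div_sqrt_le {η : ℝ} (hP : IsProblem f ψ G g) (hη : 0 < η)
    (hx₁ : x₁ ∈ dom ψ) (hX : ∀ σ, IsProxRun ψ g T (fun t => η / √t) (tupleIndex σ) x₁ (X σ))
    (hK : T ≤ K * n) (hz : z ∈ dom ψ) (hnT : n ≤ T) :
    1 / (n : ℝ) * ∑ t ∈ Finset.Icc (T - n + 1) T, Finset.univ.expect (fun σ =>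
        realObjective f ψ (X σ (t + 1)) - realObjective f ψ z)
      ≤ 120 * ((‖z - x₁‖ ^ 2 / η + η * √n * G1 G * G2 G * (1 + Real.log T)) * (1 / √T)) := by
  have hn : (0 : ℝ) < n := by exact_mod_cast Nat.pos_of_neZero n
  have hG1 := G1_nonneg G
  have hG2 := G2_nonneg G
  set B := ‖z - x₁‖ ^ 2 / η + η * √n * G1 G * G2 G * (1 + Real.log T) with hB
  have hB0 : 0 ≤ B := by
    have := Real.log_natCast_nonneg T
    positivity
  calc _ ≤ 1 / (n : ℝ) * ∑ t ∈ Finset.Icc (T - n + 1) T, 60 * B * (1 / √(t : ℝ)) := by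
        gcongr with t ht
        have ht' := Finset.mem_Icc.1 ht
        refine (hP.expect_last_div_sqrt_le hη hx₁ hX hK hz (by omega) ht'.2).trans ?_
        have ht0 : (0 : ℝ) < t := by exact_mod_cast (by omega : 0 < t)
        have htT : (t : ℝ) ≤ T := by exact_mod_cast ht'.2
        have := Real.log_le_log ht0 htT
        rw [hB]
        gcongr
    _ ≤ 1 / (n : ℝ) * (60 * B * (2 * n / √(T : ℝ))) := by
        rw [← Finset.mul_sum]
        gcongr
        exact sum_Icc_inv_sqrt_le hnT
    _ = _ := by field_simp; ring

end IsProblem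

/-! ### Reduction to uniform averages over tuples of permutations -/

section Reduction

variable {d n T : ℕ} {Ω : Type*} {π : ℕ → Ω → Equiv.Perm (Fin n)}

/-- The permutations `π 0, …, π (⌈T/n⌉ - 1)` used in the successive epochs, as a random tuple. -/
def permTuple (T : ℕ) (π : ℕ → Ω → Equiv.Perm (Fin n)) (ω : Ω) :
    Fin (T ⌈/⌉ n) → Equiv.Perm (Fin n) := fun k => π k ω

theorem permTuple_preimage (σ : Fin (T ⌈/⌉ n) → Equiv.Perm (Fin n)) :
    permTuple T π ⁻¹' {σ} = ⋂ k ∈ (Finset.univ : Finset (Fin (T ⌈/⌉ n))), π k ⁻¹' {σ k} := by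
  ext ω
  simp [permTuple, funext_iff]

theorem le_ceilDiv_mul [NeZero n] : T ≤ (T ⌈/⌉ n) * n := by
  have h := (ceilDiv_le_iff_le_mul (Nat.pos_of_neZero n)).1 (le_refl (T ⌈/⌉ n))
  linarith

theorem rrIndex_eq_tupleIndex [NeZero n] (ω : Ω) {t : ℕ} (h1 : 1 ≤ t) (ht : t ≤ T) :
    rrIndex π ω t = tupleIndex (permTuple T π ω) t := by
  have h : (t - 1) / n < T ⌈/⌉ n := by
    rw [Nat.div_lt_iff_lt_mul (Nat.pos_of_neZero n)]
    have := le_ceilDiv_mul (T := T) (n := n)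
    omega
  rw [tupleIndex, dif_pos h]
  rfl

theorem suffixAvg_congr {x x' : ℕ → E d} (h : ∀ t, 1 ≤ t → t ≤ T + 1 → x t = x' t) :
    suffixAvg n T x = suffixAvg n T x' := by
  unfold suffixAvg
  congr 1
  refine Finset.sum_congr rfl fun t ht => ?_
  have := Finset.mem_Icc.1 ht
  exact h _ (by omega) (by omega)

variable [MeasurableSpace Ω] {μ : Measure Ω}

theorem IsReshuffle.measurableSet_preimage (hπ : IsReshuffle T μ π)
    (σ : Fin (T ⌈/⌉ n) → Equiv.Perm (Fin n)) : MeasurableSet (permTuple T π ⁻¹' {σ}) := by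
  rw [permTuple_preimage]
  exact Finset.measurableSet_biInter _ fun k _ => hπ.measurable k k.2 trivial

theorem IsReshuffle.measureReal_preimage (hπ : IsReshuffle T μ π)
    (σ : Fin (T ⌈/⌉ n) → Equiv.Perm (Fin n)) :
    μ.real (permTuple T π ⁻¹' {σ})
      = (Fintype.card (Fin (T ⌈/⌉ n) → Equiv.Perm (Fin n)) : ℝ)⁻¹ := by
  rw [permTuple_preimage, Measure.real, hπ.indep.measure_inter_preimage_eq_mul _
    fun _ _ => trivial, ENNReal.toReal_prod]
  have h : ∀ k : Fin (T ⌈/⌉ n), (μ (π k ⁻¹' {σ k})).toReal = 1 / (n ! : ℝ) :=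
    fun k => hπ.uniform k k.2 (σ k)
  simp [h, Fintype.card_perm]

theorem IsReshuffle.integral_permTuple [IsProbabilityMeasure μ] (hπ : IsReshuffle T μ π)
    (h : (Fin (T ⌈/⌉ n) → Equiv.Perm (Fin n)) → ℝ) :
    Integrable (fun ω => h (permTuple T π ω)) μ ∧
      ∫ ω, h (permTuple T π ω) ∂μ = Finset.univ.expect h := by
  have e : (fun ω => h (permTuple T π ω))
      = fun ω => ∑ σ, (permTuple T π ⁻¹' {σ}).indicator (fun _ => h σ) ω := by
    funext ω
    rw [Finset.sum_eq_single (permTuple T π ω)]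
    · simp
    · intro σ _ hσ
      exact Set.indicator_of_notMem (s := permTuple T π ⁻¹' {σ})
        (fun hω => hσ (Set.mem_singleton_iff.1 hω).symm) _
    · simp
  have hi : ∀ σ, Integrable ((permTuple T π ⁻¹' {σ}).indicator fun _ => h σ) μ := fun σ =>
    (integrable_const _).indicator (hπ.measurableSet_preimage σ)
  rw [e]
  refine ⟨integrable_finsetSum _ fun σ _ => hi σ, ?_⟩
  rw [integral_finsetSum _ fun σ _ => hi σ, Finset.expect_eq_sum_div_card, Finset.sum_div]
  refine Finset.sum_congr rfl fun σ _ => ?_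
  rw [integral_indicator_const _ (hπ.measurableSet_preimage σ), hπ.measureReal_preimage,
    Finset.card_univ, smul_eq_mul, inv_mul_eq_div]

theorem IsReshuffle.exists_permTuple_eq (hπ : IsReshuffle T μ π)
    (σ : Fin (T ⌈/⌉ n) → Equiv.Perm (Fin n)) : ∃ ω, permTuple T π ω = σ := by
  by_contra! hne
  have h := hπ.measureReal_preimage σ
  have e : permTuple T π ⁻¹' {σ} = ∅ := Set.eq_empty_of_forall_notMem fun ω hω => hne ω hω
  rw [e, measureReal_empty] at h
  exact (inv_ne_zero (Nat.cast_ne_zero.2 Fintype.card_ne_zero)) h.symm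

end Reduction

namespace IsProblem

variable {d n T : ℕ} {f : Fin n → E d → ℝ} {ψ : E d → EReal} {G : Fin n → ℝ≥0}
  {g : Fin n → E d → E d} {η : ℕ → ℝ} {x₁ z : E d}

theorem objective_eq (hP : IsProblem f ψ G g) (hz : z ∈ dom ψ) :
    objective f ψ z = (realObjective f ψ z : EReal) := by
  rw [objective, realObjective, EReal.coe_add, hP.convex_ψ.coe_toReal hz]

theorem convexOn_realObjective (hP : IsProblem f ψ G g) :
    ConvexOn ℝ (dom ψ) (realObjective f ψ) := by
  have hc := hP.convex_ψ.convexOn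
  refine ConvexOn.add ⟨hc.1, fun x _ y _ a b ha hb hab => ?_⟩ hc
  simp only [avgFun, smul_eq_mul]
  rw [mul_left_comm, mul_left_comm b, ← mul_add, Finset.mul_sum (a := a), Finset.mul_sum (a := b),
    ← Finset.sum_add_distrib]
  gcongr with i
  exact (hP.convex_f i).2 (Set.mem_univ x) (Set.mem_univ y) ha hb hab

theorem realObjective_suffixAvg_le [NeZero n] (hP : IsProblem f ψ G g) (hnT : n ≤ T) {x : ℕ → E d}
    (hx : ∀ t, 1 ≤ t → t ≤ T + 1 → x t ∈ dom ψ) :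
    suffixAvg n T x ∈ dom ψ ∧ realObjective f ψ (suffixAvg n T x)
      ≤ 1 / (n : ℝ) * ∑ t ∈ Finset.Icc (T - n + 1) T, realObjective f ψ (x (t + 1)) := by
  have hn : (0 : ℝ) < n := by exact_mod_cast Nat.pos_of_neZero n
  have hc := hP.convexOn_realObjective
  have hw : ∑ _t ∈ Finset.Icc (T - n + 1) T, (1 / (n : ℝ)) = 1 := by
    have ecard : T + 1 - (T - n + 1) = n := by omega
    rw [Finset.sum_const, Nat.card_Icc, ecard, nsmul_eq_mul]
    field_simp
  have hm : ∀ t ∈ Finset.Icc (T - n + 1) T, x (t + 1) ∈ dom ψ := fun t ht => by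
    have := Finset.mem_Icc.1 ht
    exact hx _ (by omega) (by omega)
  rw [suffixAvg, Finset.smul_sum, Finset.mul_sum]
  exact ⟨hc.1.sum_mem (fun _ _ => by positivity) hw hm,
    hc.map_sum_le (fun _ _ => by positivity) hw hm⟩

/-- It suffices to bound averages over all tuples of permutations: the run is a function of the
tuple, because proximal steps are unique, and every tuple occurs, with the same probability. -/
theorem expGapLE_of_expect_le [NeZero n] {Ω : Type*} [MeasurableSpace Ω] {μ : Measure Ω}
    [IsProbabilityMeasure μ] {π : ℕ → Ω → Equiv.Perm (Fin n)} {x : Ω → ℕ → E d} {B : ℝ}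
    (hP : IsProblem f ψ G g) (hη : IsStepsize η) (hx₁ : x₁ ∈ dom ψ) (hnT : n ≤ T)
    (hπ : IsReshuffle T μ π) (hx : ∀ ω, IsProxRun ψ g T η (rrIndex π ω) x₁ (x ω))
    (hB : ∀ X : (Fin (T ⌈/⌉ n) → Equiv.Perm (Fin n)) → ℕ → E d,
      (∀ σ, IsProxRun ψ g T η (tupleIndex σ) x₁ (X σ)) → z ∈ dom ψ →
        1 / (n : ℝ) * ∑ t ∈ Finset.Icc (T - n + 1) T, Finset.univ.expect (fun σ =>
          realObjective f ψ (X σ (t + 1)) - realObjective f ψ z) ≤ B) :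
    ExpGapLE μ (fun ω => objective f ψ (suffixAvg n T (x ω))) (objective f ψ z) B := by
  have hn : (n : ℝ) ≠ 0 := by exact_mod_cast NeZero.ne n
  have hx' : ∀ ω, IsProxRun ψ g T η (tupleIndex (permTuple T π ω)) x₁ (x ω) := fun ω =>
    ⟨(hx ω).init, fun t ht => by
      have ht' := Finset.mem_Icc.1 ht
      rw [← rrIndex_eq_tupleIndex ω ht'.1 ht'.2]
      exact (hx ω).step t ht⟩
  choose ω₀ hω₀ using hπ.exists_permTuple_eq
  let X : (Fin (T ⌈/⌉ n) → Equiv.Perm (Fin n)) → ℕ → E d := fun σ => x (ω₀ σ)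
  have hX : ∀ σ, IsProxRun ψ g T η (tupleIndex σ) x₁ (X σ) := fun σ => by
    have := hx' (ω₀ σ)
    rwa [hω₀] at this
  have hJ := fun σ => hP.realObjective_suffixAvg_le hnT (x := X σ) fun t h1 h2 =>
    mem_dom_of_run hx₁ (hX σ) h1 h2
  have hY : ∀ ω, objective f ψ (suffixAvg n T (x ω))
      = (realObjective f ψ (suffixAvg n T (X (permTuple T π ω))) : EReal) := by
    intro ω
    rw [← hP.objective_eq (hJ _).1]
    congr 1
    exact suffixAvg_congr fun t h1 h2 =>
      hP.run_eq hη.pos hx₁ (hx' ω) (hX _) h1 h2 fun _ _ _ => rfl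
  obtain ⟨hint, heq⟩ := hπ.integral_permTuple fun σ => realObjective f ψ (suffixAvg n T (X σ))
  simp only [ExpGapLE, hY, EReal.toReal_coe]
  refine ⟨fun ω => ⟨EReal.coe_ne_bot _, EReal.coe_ne_top _⟩, hint, ?_⟩
  by_cases hz : z ∈ dom ψ
  · rw [hP.objective_eq hz, ← EReal.coe_sub, EReal.coe_le_coe_iff, heq]
    refine le_trans ?_ (hB X hX hz)
    have h := Finset.expect_le_expect (s := Finset.univ) fun σ _ => (hJ σ).2
    rw [← Finset.mul_expect, Finset.expect_sum_comm] at h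
    simp only [Finset.expect_sub_distrib, Finset.expect_const Finset.univ_nonempty,
      Finset.sum_sub_distrib, Finset.sum_const, Nat.card_Icc, nsmul_eq_mul]
    have ecard : T + 1 - (T - n + 1) = n := by omega
    rw [ecard, mul_sub, ← mul_assoc (1 / (n : ℝ)) (n : ℝ), one_div_mul_cancel hn, one_mul]
    linarith
  · -- at a point of infinite value the gap is `-∞`
    have hz' : ψ z = ⊤ := not_lt_top_iff.1 hz
    rw [objective, hz', EReal.coe_add_top, EReal.sub_top]
    exact bot_le

end IsProblem

end ShuffledProx

/-! ### The three bounds -/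

theorem corollary2 :
    -- one absolute constant for all three bounds
    ∃ C : ℝ, 0 < C ∧
    ∀ (d n : ℕ) [NeZero n]
      (f : Fin n → E d → ℝ) (ψ : E d → EReal) (G : Fin n → ℝ≥0)
      (g : Fin n → E d → E d),
      -- convexity
      (∀ i, ConvexOn ℝ Set.univ (f i)) →
      ProperClosedConvex ψ →
      -- Lipschitz continuity on the domain of `ψ`
      (∀ i, 0 < G i) →
      (∀ i, LipschitzOnWith (G i) (f i) (dom ψ)) →
      -- `g i y` is the subgradient of `f i` that the method uses at `y`
      (∀ i y, g i y ∈ subdifferential (f i) y) →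
      -- its linear form has the Lipschitz constant of `f i` on the domain of `ψ`
      (∀ i, ∀ y ∈ dom ψ,
        LipschitzOnWith (G i) (fun u => ⟪g i y, u⟫_ℝ) (dom ψ)) →
    ∀ (T : ℕ), n ≤ T →
    ∀ (Ω : Type*) [MeasurableSpace Ω] (μ : Measure Ω) [IsProbabilityMeasure μ]
      (π : ℕ → Ω → Equiv.Perm (Fin n)), IsReshuffle T μ π →
    ∀ x₁ ∈ dom ψ, ∀ x : Ω → ℕ → E d,
      -- constant stepsize
      (∀ η : ℝ, 0 < η → 2 * (n - 1) ≤ T →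
        (∀ ω, IsProxRun ψ g T (fun _ => η) (rrIndex π ω) x₁ (x ω)) →
        ∀ z : E d,
          ExpGapLE μ
            (fun ω => objective f ψ (suffixAvg n T (x ω)))
            (objective f ψ z)
            (C * (‖z - x₁‖ ^ 2 / (η * T) +
              η * √n * G1 G * G2 G * (1 + Real.log T)))) ∧
      -- stepsize `η / √t`, arbitrary `η > 0`
      (∀ η : ℝ, 0 < η →
        (∀ ω, IsProxRun ψ g T (fun t => η / √t)
          (rrIndex π ω) x₁ (x ω)) →
        ∀ z : E d,
          ExpGapLE μ
            (fun ω => objective f ψ (suffixAvg n T (x ω)))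
            (objective f ψ z)
            (C * ((‖z - x₁‖ ^ 2 / η +
              η * √n * G1 G * G2 G * (1 + Real.log T)) *
                (1 / √T)))) ∧
      -- stepsize `η / √t` with the optimized `η`, compared with the minimum value of `F`
      (∀ xstar : E d,
        objective f ψ xstar = ⨅ y, objective f ψ y →
        xstar ≠ x₁ →
        (∀ ω, IsProxRun ψ g T
          (fun t => ‖xstar - x₁‖ /
            ((n : ℝ) ^ (1 / 4 : ℝ) * √(G1 G * G2 G)) / √t)
          (rrIndex π ω) x₁ (x ω)) →
        ExpGapLE μ
          (fun ω => objective f ψ (suffixAvg n T (x ω)))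
          (⨅ y, objective f ψ y)
          (C * ((n : ℝ) ^ (1 / 4 : ℝ) * √(G1 G * G2 G) *
            ‖xstar - x₁‖ * (1 + Real.log T) / √T))) := by
  refine ⟨240, by norm_num, ?_⟩
  intro d n _ f ψ G g hf hψ hG hlip hsub hlin T hnT Ω _ μ _ π hπ x₁ hx₁ x
  have hP : IsProblem f ψ G g := ⟨hf, hψ, hG, hlip, hsub, hlin⟩
  have hn : (0 : ℝ) < n := by exact_mod_cast Nat.pos_of_neZero n
  have hG1 : 0 < G1 G := G1_pos G hG
  have hG2 : 0 < G2 G := hG1.trans_le (G1_le_G2 G)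
  have hlog : 0 ≤ Real.log T := Real.log_natCast_nonneg T
  refine ⟨fun η hη _ hx z => ?_, fun η hη hx z => ?_, fun xstar hmin hne hx => ?_⟩
  · refine hP.expGapLE_of_expect_le (isStepsize_const hη) hx₁ hnT hπ hx fun X hX hz =>
      (hP.expect_suffix_const_le hη hx₁ hX le_ceilDiv_mul hz hnT).trans ?_
    gcongr
    norm_num
  · refine hP.expGapLE_of_expect_le (isStepsize_div_sqrt hη) hx₁ hnT hπ hx fun X hX hz =>
      (hP.expect_suffix_div_sqrt_le hη hx₁ hX le_ceilDiv_mul hz hnT).trans ?_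
    gcongr
    norm_num
  · have hD : 0 < ‖xstar - x₁‖ := norm_pos_iff.2 (sub_ne_zero.2 hne)
    have hw : 0 < (n : ℝ) ^ (1 / 4 : ℝ) := Real.rpow_pos_of_pos hn _
    have hv : 0 < √(G1 G * G2 G) := Real.sqrt_pos.2 (mul_pos hG1 hG2)
    have hw2 : √(n : ℝ) = ((n : ℝ) ^ (1 / 4 : ℝ)) ^ 2 := by
      rw [Real.sqrt_eq_rpow, ← Real.rpow_natCast, ← Real.rpow_mul hn.le]
      norm_num
    have hv2 : √(G1 G * G2 G) ^ 2 = G1 G * G2 G := Real.sq_sqrt (mul_pos hG1 hG2).le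
    rw [← hmin]
    refine hP.expGapLE_of_expect_le (isStepsize_div_sqrt (div_pos hD (mul_pos hw hv))) hx₁ hnT
      hπ hx fun X hX hz => (hP.expect_suffix_div_sqrt_le (div_pos hD (mul_pos hw hv)) hx₁ hX
        le_ceilDiv_mul hz hnT).trans ?_
    generalize √(G1 G * G2 G) = v at *
    rw [mul_assoc _ (G1 G) (G2 G), ← hv2, hw2]
    generalize (n : ℝ) ^ (1 / 4 : ℝ) = w at *
    generalize ‖xstar - x₁‖ = D at *
    -- the optimized stepsize balances the two error terms
    have e : 120 * ((D ^ 2 / (D / (w * v)) + D / (w * v) * w ^ 2 * v ^ 2 * (1 + Real.log T))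
        * (1 / √T)) = 120 * (w * v * D * (2 + Real.log T) / √T) := by
      field_simp
      ring
    rw [e]
    have h : w * v * D * (2 + Real.log T) / √T ≤ 2 * (w * v * D * (1 + Real.log T) / √T) := by
      rw [← mul_div_assoc]
      gcongr ?_ / _
      nlinarith [mul_nonneg (mul_pos (mul_pos hw hv) hD).le hlog]
    linarith
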